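/- Let $l>0$, let $\lambda$ be a positive integer, and let $P'$ be the parallelogram in the plane with all sides of length $L=\lambda l$ and acute angle $\pi/3$, whose opposite sides are identified by translations to give a flat torus. We say that the tessellation $\{6,3\}$ of the plane by regular hexagons of edge length $l$ (in any position) tiles $P'$ if it is invariant under these translations, so that it descends to a tessellation of the torus; its dual $\{3,6\}$ then descends as well. If $3\mid\lambda$, then $P'$ is tiled by the hexagonal tessellation that has an edge direction parallel to a side of $P'$ and a hexagon centred at a corner of $P'$. Conversely, suppose that a hexagonal tessellation of edge length $l$ tiles $P'$. Then $3\mid\lambda$. Put a qubit on every edge of the resulting finite tessellation of the torus and let $Q$ be the space of the states fixed by all face operators $X_f=\bigotimes_{j\in E_f}X^j$ and all vertex operators $Z_v=\bigotimes_{j\in E_v}Z^j$, where $E_f$ is the set of edges on the border of the face $f$ and $E_v$ is the set of edges ending at the vertex $v$. Then $Q$ is a toric asymmetric topological quantum code with parameters $$\left[\left[\lambda^2,\;2,\;\left\lceil \lambda/\sqrt3\,\right\rceil \,/\,\lambda\right]\right],$$ meaning the following. The number of qubits is $n=\lambda^2$; $\dim_{\mathbb C} Q=2^2$; and, with $d_x=\lambda$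 and $d_z=\lceil\lambda/\sqrt3\rceil$, the code $Q$ corrects all errors $X_aZ_b$ that consist of at most $\lfloor (d_x-1)/2\rfloor$ bit flips and at most $\lfloor (d_z-1)/2\rfloor$ phase shifts. Moreover, the $X$-distance of $Q$ (the number of edges of a shortest homologically nontrivial cycle over $\mathbb Z_2$ of the hexagonal tessellation of the torus) is at least $\lambda$, the $Z$-distance of $Q$ (the same for the dual tessellation) is at least $\lceil\lambda/\sqrt3\rceil$, and these two distances are different. -/

import Mathlib

noncomputable section

namespace HexToric

/-! ### Qubits, Pauli operators and error correction -/

section Qubits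

variable {ι : Type*}

/-- The state space `(ℂ²)^{⊗ ι}` of qubits labelled by `ι`, written in the computational basis:
the basis vector `|x⟩` is the indicator function of the bit string `x : ι → ZMod 2`. -/
abbrev QubitSpace (ι : Type*) : Type _ := EuclideanSpace ℂ (ι → ZMod 2)

/-- The bit-flip operator `X_a = ⨂ i, X ^ (a i)`, that is `X_a |x⟩ = |x + a⟩`. -/
def pauliX (a : ι → ZMod 2) : QubitSpace ι →ₗ[ℂ] QubitSpace ι where
  toFun ψ := WithLp.toLp 2 fun x => ψ (x - a)
  map_add' _ _ := rfl
  map_smul' _ _ := rfl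

/-- The phase-shift operator `Z_b = ⨂ i, Z ^ (b i)`, that is `Z_b |x⟩ = (-1) ^ (b · x) |x⟩`. -/
def pauliZ [Fintype ι] (b : ι → ZMod 2) : QubitSpace ι →ₗ[ℂ] QubitSpace ι where
  toFun ψ := WithLp.toLp 2 fun x => (-1 : ℂ) ^ (∑ i, b i * x i).val * ψ x
  map_add' ψ φ := by
    ext x
    simp [mul_add]
  map_smul' c ψ := by
    ext x
    simp [mul_left_comm]

/-- The weight of a bit vector: the number of its nonzero entries. -/
def weight [Fintype ι] (a : ι → ZMod 2) : ℕ :=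
  (Finset.univ.filter fun i => a i ≠ 0).card

open Classical in
/-- The subspace `Q` corrects the set `errs` of error operators: there is a recovery operation,
i.e. a trace-preserving quantum channel with Kraus operators `R j`, that undoes every error of
`errs` on every state of `Q` (up to a scalar that does not depend on the state). -/
def Corrects [Fintype ι] (Q : Submodule ℂ (QubitSpace ι))
    (errs : Set (QubitSpace ι →ₗ[ℂ] QubitSpace ι)) : Prop :=
  ∃ (N : ℕ) (R : Fin N → (QubitSpace ι →ₗ[ℂ] QubitSpace ι)),
    (∑ j, LinearMap.adjoint (R j) ∘ₗ R j = LinearMap.id) ∧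
    ∀ e ∈ errs, ∀ j, ∃ c : ℂ, ∀ ψ ∈ Q, R j (e ψ) = c • ψ

/-- The subspace `Q` is an asymmetric quantum error-correcting code with parameters
`[[n, k, dz / dx]]`: it has length `n` and dimension `2 ^ k`, and it corrects all errors
`X_a Z_b` with at most `⌊(dx - 1) / 2⌋` bit flips and at most `⌊(dz - 1) / 2⌋` phase shifts. -/
def IsAsymmetricCode [Fintype ι] (Q : Submodule ℂ (QubitSpace ι)) (n k dz dx : ℕ) : Prop :=
  Fintype.card ι = n ∧
  Module.finrank ℂ Q = 2 ^ k ∧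
  Corrects Q {e | ∃ a b : ι → ZMod 2,
    weight a ≤ (dx - 1) / 2 ∧ weight b ≤ (dz - 1) / 2 ∧ e = pauliX a ∘ₗ pauliZ b}

end Qubits

/-! ### Tessellations of surfaces and their topological codes -/

/-- The incidence data of a tessellation of a surface: `endpoint v e` says that the vertex `v` is
an end of the edge `e`, and `border e f` says that the edge `e` lies on the border of the
face `f`. -/
structure Tessellation where
  V : Type
  E : Type
  F : Type
  endpoint : V → E → Prop
  border : E → F → Prop

namespace Tessellation

variable (T : Tessellation)

/-- The dual tessellation: a vertex for every face, a face for every vertex, and the same edges. -/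
def dual : Tessellation where
  V := T.F
  E := T.E
  F := T.V
  endpoint f e := T.border e f
  border e v := T.endpoint v e

open Classical in
/-- The `ZMod 2`-chain of the edges on the border of a face. -/
def faceChain (f : T.F) : T.E → ZMod 2 := fun e => if T.border e f then 1 else 0

open Classical in
/-- The `ZMod 2`-chain of the edges that have the vertex `v` as an end. -/
def starChain (v : T.V) : T.E → ZMod 2 := fun e => if T.endpoint v e then 1 else 0

/-- The boundary operator from `2`-chains (formal sums of faces) to `1`-chains, over `ZMod 2`. -/
def boundary₂ : (T.F →₀ ZMod 2) →ₗ[ZMod 2] (T.E → ZMod 2) :=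
  Finsupp.linearCombination (ZMod 2) T.faceChain

/-- The boundary operator from `1`-chains to `0`-chains, over `ZMod 2`: the coefficient of `v` in
the boundary of `c` is the sum of the coefficients in `c` of the edges at `v`. -/
def boundary₁ [Fintype T.E] : (T.E → ZMod 2) →ₗ[ZMod 2] (T.V → ZMod 2) where
  toFun c v := ∑ e, T.starChain v e * c e
  map_add' c d := by
    ext v
    simp [mul_add, Finset.sum_add_distrib]
  map_smul' r c := by
    ext v
    simp [Finset.mul_sum, mul_left_comm]

/-- The numbers of edges of the homologically nontrivial cycles of `T`, i.e. of the `1`-cycles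
that are not boundaries. -/
def nontrivialCycleLengths [Fintype T.E] : Set ℕ :=
  {w | ∃ c : T.E → ZMod 2,
    c ∈ LinearMap.ker T.boundary₁ ∧ c ∉ LinearMap.range T.boundary₂ ∧ weight c = w}

/-- `d` is the `X`-distance of the topological code of `T`: the number of edges of a shortest
homologically nontrivial cycle of `T`. -/
def IsXDistance [Fintype T.E] (d : ℕ) : Prop := IsLeast T.nontrivialCycleLengths d

/-- `d` is the `Z`-distance of the topological code of `T`: the number of edges of a shortest
homologically nontrivial cycle of the dual of `T`. -/
def IsZDistance [inst : Fintype T.E] (d : ℕ) : Prop :=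
  IsLeast (@nontrivialCycleLengths T.dual inst) d

/-- The topological code of `T`, with one qubit on every edge: the space of the states fixed by
all face operators `X_f` and all vertex operators `Z_v`. -/
def code [Fintype T.E] : Submodule ℂ (QubitSpace T.E) where
  carrier := {ψ | (∀ f, pauliX (T.faceChain f) ψ = ψ) ∧ (∀ v, pauliZ (T.starChain v) ψ = ψ)}
  add_mem' := fun ⟨h₁, h₂⟩ ⟨h₃, h₄⟩ =>
    ⟨fun f => by rw [map_add, h₁, h₃], fun v => by rw [map_add, h₂, h₄]⟩
  zero_mem' := ⟨fun _ => map_zero _, fun _ => map_zero _⟩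
  smul_mem' := fun _ _ ⟨h₁, h₂⟩ =>
    ⟨fun f => by rw [map_smul, h₁], fun v => by rw [map_smul, h₂]⟩

end Tessellation

/-! ### The hexagonal tessellation of the plane and of the flat torus -/

/-- The sixth root of unity `exp (π i / 3)`. -/
def ω : ℂ := Complex.exp (Real.pi / 3 * Complex.I)

/-- The `k`-th corner of the regular hexagon with centre `c` and edge length `l` that has a corner
in the direction of the unit vector `u` from the centre (`k` counts modulo `6`). The edges of the
hexagon join consecutive corners; one pair of them is parallel to `u`. -/
def corner (l : ℝ) (u c : ℂ) (k : ℕ) : ℂ := c + l * u * ω ^ k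

/-- The centres of the hexagons of the tessellation `{6,3}` of the plane by such hexagons, one of
which has its centre at `c₀`. The centres of neighbouring hexagons differ by
`l * u * (ω ^ k + ω ^ (k + 1))`, twice the apothem in length. -/
def centers (l : ℝ) (u c₀ : ℂ) : Set ℂ :=
  {c | ∃ a b : ℤ, c = c₀ + l * u * (1 + ω) * (a + b * ω)}

/-- The group generated by the two translations that identify opposite sides of the
parallelogram with corners `0`, `L`, `L * ω`, `L + L * ω`, where `ω = exp (π i / 3)`: its sides
have length `L` and its acute angle is `π / 3`. -/
def periods (L : ℝ) : AddSubgroup ℂ := AddSubgroup.closure {(L : ℂ), L * ω}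

/-- The parallelogram of side `L` is tiled by the hexagonal tessellation: the latter is invariant
under the side identifications of the parallelogram, so that it descends to the flat torus. -/
def TilesParallelogram (l : ℝ) (u c₀ : ℂ) (L : ℝ) : Prop :=
  ∀ t ∈ periods L, ∀ c ∈ centers l u c₀, t + c ∈ centers l u c₀

/-- The flat torus obtained from the parallelogram of side `L`. -/
abbrev FlatTorus (L : ℝ) : Type := ℂ ⧸ periods L

/-- The edge of the torus that is the image of the edge from the `k`-th to the `(k + 1)`-st corner
of the hexagon with centre `c`, given by its pair of end points. (When the parallelogram is tiled,
`L ≥ 3 * l`, and different edges of the torus have different pairs of end points.) -/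
def torusEdge (l : ℝ) (u : ℂ) (L : ℝ) (c : ℂ) (k : ℕ) : Sym2 (FlatTorus L) :=
  s((corner l u c k : FlatTorus L), (corner l u c (k + 1) : FlatTorus L))

/-- The tessellation of the flat torus by the images of the hexagons. A face is given by the image
of its centre. -/
def hexTorus (l : ℝ) (u c₀ : ℂ) (L : ℝ) : Tessellation where
  V := {p : FlatTorus L // ∃ c ∈ centers l u c₀, ∃ k : ℕ, p = (corner l u c k : FlatTorus L)}
  E := {e : Sym2 (FlatTorus L) // ∃ c ∈ centers l u c₀, ∃ k : ℕ, e = torusEdge l u L c k}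
  F := {p : FlatTorus L // ∃ c ∈ centers l u c₀, p = (c : FlatTorus L)}
  endpoint v e := v.1 ∈ e.1
  border e f := ∃ c ∈ centers l u c₀, f.1 = (c : FlatTorus L) ∧ ∃ k : ℕ, e.1 = torusEdge l u L c k

end HexToric

end

/-! The centres of the hexagons form a coset of the lattice `l * u * (1 + ω) * ℤ[ω]`. Invariance
under the translation by `L` makes `L = l * u * (1 + ω) * (p + q * ω)` for some Eisenstein integer
(`exists_tilingData`). Taking squared norms gives `lam ^ 2 = 3 * N` with `N = p ^ 2 + p * q + q ^
2`; hence `3 ∣ lam`. In lattice coordinates the tessellated torus is `ℤ[ω]` modulo the multiples of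
`p + q * ω` (`hexModel`, `TilingData.iso`), with `N` hexagons, `2 * N` vertices and `3 * N = lam ^
2` edges.

Vertex operators confine a state of the code to cycles, and face operators make its amplitude
constant on homology classes, so the code has dimension `|H₁| = 2 ^ 2`. The rank of `H₁` comes from
counting, since the graph and its dual are connected (`finrank_ker_hexModel`).

For the distances, each edge carries the period by which it leaves the chosen lifts of its ends. The
sum of these periods modulo two is a map from chains to `(ZMod 2)²` that kills the faces and is onto
on cycles, so by dimension it detects homology. A cycle with nonzero holonomy contains a closed walk
whose lift to the plane ends a nonzero period away from its start, hence has length at least `L`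
(`le_weight_of_holonomy_ne_zero`). Edges have length `l` and dual edges `√3 * l`, which gives the
two lower bounds. Error correction follows because two admissible errors differ by a stabilizer up
to sign or are told apart by one. Finally the period `L` can be walked through fewer than `lam`
hexagons (`TilingData.exists_short_walk`), so the `Z`-distance is less than the `X`-distance. -/

noncomputable section

namespace HexToric

/-! ### Commutation relations and isometry of Pauli operators. -/

section Pauli

variable {ι : Type*}

lemma pauliX_apply (a : ι → ZMod 2) (ψ : QubitSpace ι) (x : ι → ZMod 2) :
    pauliX a ψ x = ψ (x - a) := rfl

lemma zmod_two_eq_zero_or_one (s : ZMod 2) : s = 0 ∨ s = 1 := by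
  revert s
  decide

lemma zmod_two_eq_one_of_ne_zero {s : ZMod 2} (h : s ≠ 0) : s = 1 :=
  (zmod_two_eq_zero_or_one s).resolve_left h

/-- The character `s ↦ (-1) ^ s` of `ZMod 2`. -/
def sign (s : ZMod 2) : ℂ := (-1) ^ s.val

lemma sign_add (s t : ZMod 2) : sign (s + t) = sign s * sign t := by
  have h0 : sign 0 = 1 := by simp [sign]
  have h1 : sign 1 = -1 := by simp [sign, ZMod.val_one]
  rcases zmod_two_eq_zero_or_one s with rfl | rfl <;>
    rcases zmod_two_eq_zero_or_one t with rfl | rfl <;>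
    simp [h0, h1, CharTwo.add_self_eq_zero]

lemma sign_zero : sign 0 = 1 := by simp [sign]

lemma sign_one : sign 1 = -1 := by simp [sign, ZMod.val_one]

lemma sign_mul_self (s : ZMod 2) : sign s * sign s = 1 := by
  rw [← sign_add, CharTwo.add_self_eq_zero, sign_zero]

lemma conj_sign (s : ZMod 2) : (starRingEnd ℂ) (sign s) = sign s := by
  simp [sign]

lemma pauliX_pauliX (a b : ι → ZMod 2) (ψ : QubitSpace ι) :
    pauliX a (pauliX b ψ) = pauliX (a + b) ψ := by
  ext x
  simp [pauliX_apply, sub_sub]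

lemma pauliX_zero (ψ : QubitSpace ι) : pauliX 0 ψ = ψ := by
  ext x
  simp [pauliX_apply]

lemma pauliX_fixed_of_mem_span {s : Set (ι → ZMod 2)} {ψ : QubitSpace ι}
    (h : ∀ a ∈ s, pauliX a ψ = ψ) {a : ι → ZMod 2} (ha : a ∈ Submodule.span (ZMod 2) s) :
    pauliX a ψ = ψ := by
  induction ha using Submodule.span_induction with
  | mem a ha => exact h a ha
  | zero => exact pauliX_zero ψ
  | add a b _ _ ha hb => rw [← pauliX_pauliX, hb, ha]
  | smul r a _ ha =>
    rcases zmod_two_eq_zero_or_one r with rfl | rfl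
    · rw [zero_smul, pauliX_zero]
    · rw [one_smul, ha]

lemma chain_add_self (a : ι → ZMod 2) : a + a = 0 := by
  ext i
  exact CharTwo.add_self_eq_zero _

variable [Fintype ι]

lemma pauliZ_apply (b : ι → ZMod 2) (ψ : QubitSpace ι) (x : ι → ZMod 2) :
    pauliZ b ψ x = sign (b ⬝ᵥ x) * ψ x := rfl

lemma pauliZ_pauliZ (a b : ι → ZMod 2) (ψ : QubitSpace ι) :
    pauliZ a (pauliZ b ψ) = pauliZ (a + b) ψ := by
  ext x
  simp [pauliZ_apply, add_dotProduct, sign_add, mul_assoc]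

lemma pauliZ_zero (ψ : QubitSpace ι) : pauliZ 0 ψ = ψ := by
  ext x
  simp [pauliZ_apply, sign_zero]

lemma pauliZ_pauliX (a b : ι → ZMod 2) (ψ : QubitSpace ι) :
    pauliZ b (pauliX a ψ) = sign (b ⬝ᵥ a) • pauliX a (pauliZ b ψ) := by
  ext x
  simp only [pauliZ_apply, pauliX_apply, PiLp.smul_apply, smul_eq_mul, ← mul_assoc, ← sign_add]
  rw [← dotProduct_add, add_sub_cancel]

lemma pauliX_pauliZ (a b : ι → ZMod 2) (ψ : QubitSpace ι) :
    pauliX a (pauliZ b ψ) = sign (b ⬝ᵥ a) • pauliZ b (pauliX a ψ) := by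
  rw [pauliZ_pauliX, smul_smul, sign_mul_self, one_smul]

lemma pauliZ_fixed_of_mem_span {s : Set (ι → ZMod 2)} {ψ : QubitSpace ι}
    (h : ∀ a ∈ s, pauliZ a ψ = ψ) {a : ι → ZMod 2} (ha : a ∈ Submodule.span (ZMod 2) s) :
    pauliZ a ψ = ψ := by
  induction ha using Submodule.span_induction with
  | mem a ha => exact h a ha
  | zero => exact pauliZ_zero ψ
  | add a b _ _ ha hb => rw [← pauliZ_pauliZ, hb, ha]
  | smul r a _ ha =>
    rcases zmod_two_eq_zero_or_one r with rfl | rfl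
    · rw [zero_smul, pauliZ_zero]
    · rw [one_smul, ha]

open Classical in
lemma inner_pauliX (a : ι → ZMod 2) (φ ψ : QubitSpace ι) :
    inner ℂ (pauliX a φ) (pauliX a ψ) = inner ℂ φ ψ := by
  simp only [PiLp.inner_apply, pauliX_apply]
  exact (Equiv.subRight a).sum_comp fun x => inner ℂ (φ x) (ψ x)

open Classical in
lemma inner_pauliZ (a : ι → ZMod 2) (φ ψ : QubitSpace ι) :
    inner ℂ (pauliZ a φ) (pauliZ a ψ) = inner ℂ φ ψ := by
  simp only [PiLp.inner_apply, pauliZ_apply]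
  refine Finset.sum_congr rfl fun x _ => ?_
  simp only [RCLike.inner_apply, map_mul, conj_sign]
  linear_combination (ψ x * (starRingEnd ℂ) (φ x)) * sign_mul_self (a ⬝ᵥ x)

lemma weight_add_le (a b : ι → ZMod 2) : weight (a + b) ≤ weight a + weight b := by
  classical
  unfold weight
  refine le_trans (Finset.card_le_card ?_) (Finset.card_union_le _ _)
  intro i
  simp only [Finset.mem_filter, Finset.mem_univ, true_and, Finset.mem_union, Pi.add_apply]
  contrapose!
  rintro ⟨h, h'⟩
  simp [h, h']

end Pauli

/-! ### Construction of a recovery channel. -/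

section Recovery

variable {ι : Type*} [Fintype ι]

open Classical in
/-- A finite set of isometric errors is correctable if any two of its members either act
proportionally on the code space or map it to orthogonal subspaces. -/
theorem corrects_of_proportional_or_orthogonal (Q : Submodule ℂ (QubitSpace ι))
    (errs : Set (QubitSpace ι →ₗ[ℂ] QubitSpace ι)) (hfin : errs.Finite)
    (hiso : ∀ e ∈ errs, ∀ φ ψ, inner ℂ (e φ) (e ψ) = inner ℂ φ ψ)
    (hpair : ∀ e ∈ errs, ∀ e' ∈ errs, (∃ c : ℂ, ∀ ψ ∈ Q, e' ψ = c • e ψ) ∨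
      ∀ φ ∈ Q, ∀ ψ ∈ Q, inner ℂ (e φ) (e' ψ) = 0) :
    Corrects Q errs := by
  -- A maximal set of errors that map `Q` to pairwise orthogonal subspaces. By maximality every
  -- error is, on `Q`, a multiple of a member of `T`.
  obtain ⟨T, hT⟩ : ∃ T : Finset (QubitSpace ι →ₗ[ℂ] QubitSpace ι), Maximal (fun T =>
      T ⊆ hfin.toFinset ∧ ∀ e ∈ T, ∀ e' ∈ T, e ≠ e' →
        ∀ φ ∈ Q, ∀ ψ ∈ Q, inner ℂ (e φ) (e' ψ) = 0) T := by
    have hf : {T : Finset (QubitSpace ι →ₗ[ℂ] QubitSpace ι) | T ⊆ hfin.toFinset ∧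
        ∀ e ∈ T, ∀ e' ∈ T, e ≠ e' →
          ∀ φ ∈ Q, ∀ ψ ∈ Q, inner ℂ (e φ) (e' ψ) = 0}.Finite :=
      (hfin.toFinset.powerset.finite_toSet).subset fun T hT => by simpa using hT.1
    exact hf.exists_maximal ⟨∅, by simp⟩
  have hTe : ∀ t ∈ T, t ∈ errs := fun t ht => by simpa using hT.prop.1 ht
  have hrep : ∀ e ∈ errs, ∃ t ∈ T, ∃ c : ℂ, ∀ ψ ∈ Q, e ψ = c • t ψ := by
    intro e he
    by_contra! hcon
    have horth : ∀ t ∈ T, ∀ φ ∈ Q, ∀ ψ ∈ Q, inner ℂ (t φ) (e ψ) = 0 := by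
      intro t ht
      refine (hpair t (hTe t ht) e he).resolve_left ?_
      rintro ⟨c, hc⟩
      obtain ⟨ψ, hψ, hne⟩ := hcon t ht c
      exact hne (hc ψ hψ)
    have heT : e ∈ T := by
      refine hT.le_of_ge (y := insert e T) ⟨?_, ?_⟩ (Finset.subset_insert _ _)
        (Finset.mem_insert_self _ _)
      · exact Finset.insert_subset (by simpa using he) hT.prop.1
      · intro s hs t ht hst φ hφ ψ hψ
        rcases Finset.mem_insert.1 hs with rfl | hs' <;> rcases Finset.mem_insert.1 ht with rfl | ht'
        · exact absurd rfl hst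
        · rw [← inner_conj_symm, horth t ht' ψ hψ φ hφ, map_zero]
        · exact horth s hs' φ hφ ψ hψ
        · exact hT.prop.2 s hs' t ht' hst φ hφ ψ hψ
    obtain ⟨ψ, -, hne⟩ := hcon e heT 1
    exact hne (one_smul _ _).symm
  let P : QubitSpace ι →ₗ[ℂ] QubitSpace ι := Q.starProjection.toLinearMap
  have hPmem : ∀ ψ, P ψ ∈ Q := fun ψ => Q.starProjection_apply_mem ψ
  have hPfix : ∀ ψ ∈ Q, P ψ = ψ := fun ψ hψ => Submodule.starProjection_eq_self_iff.2 hψ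
  have hPadj : ∀ φ ψ, inner ℂ (P φ) ψ = inner ℂ φ (P ψ) := fun φ ψ =>
    Submodule.inner_starProjection_left_eq_right Q φ ψ
  have hadj : ∀ e ∈ errs, ∀ ψ, LinearMap.adjoint e (e ψ) = ψ := by
    intro e he ψ
    refine ext_inner_left ℂ fun φ => ?_
    rw [LinearMap.adjoint_inner_right, hiso e he]
  have hcross : ∀ s ∈ T, ∀ t ∈ T, s ≠ t → ∀ ψ ∈ Q, P (LinearMap.adjoint s (t ψ)) = 0 := by
    intro s hs t ht hst ψ hψ
    refine ext_inner_left ℂ fun φ => ?_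
    rw [← hPadj, LinearMap.adjoint_inner_right, inner_zero_right]
    exact hT.prop.2 s hs t ht hst _ (hPmem φ) ψ hψ
  have hself : ∀ t ∈ T, ∀ ψ ∈ Q, P (LinearMap.adjoint t (t ψ)) = ψ := by
    intro t ht ψ hψ
    rw [hadj t (hTe t ht), hPfix ψ hψ]
  -- `A t` is the orthogonal projection onto `t(Q)` and `B` the one onto the complement of all these
  -- subspaces. The Kraus operators `P ∘ t†` map `t(Q)` back to `Q`; `B` makes the channel
  -- trace-preserving.
  let A : T → (QubitSpace ι →ₗ[ℂ] QubitSpace ι) := fun t => t.1 ∘ₗ P ∘ₗ LinearMap.adjoint t.1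
  let B : QubitSpace ι →ₗ[ℂ] QubitSpace ι := LinearMap.id - ∑ t, A t
  have hPadj' : LinearMap.adjoint P = P := by
    symm
    rw [LinearMap.eq_adjoint_iff]
    exact hPadj
  have hA : ∀ t : T, LinearMap.adjoint (P ∘ₗ LinearMap.adjoint t.1) ∘ₗ
      (P ∘ₗ LinearMap.adjoint t.1) = A t := by
    intro t
    rw [LinearMap.adjoint_comp, LinearMap.adjoint_adjoint, hPadj']
    ext1 ψ
    simp only [LinearMap.comp_apply, A]
    rw [hPfix _ (hPmem _)]
  have hAfix : ∀ t : T, ∀ ψ ∈ Q, (∑ s, A s) (t.1 ψ) = t.1 ψ := by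
    intro t ψ hψ
    rw [LinearMap.sum_apply, Finset.sum_eq_single t]
    · simp only [LinearMap.comp_apply, A]
      rw [hself t.1 t.2 ψ hψ]
    · intro s _ hst
      simp only [LinearMap.comp_apply, A]
      rw [hcross s.1 s.2 t.1 t.2 (fun h => hst (Subtype.ext h)) ψ hψ, map_zero]
    · simp
  have hBzero : ∀ t : T, ∀ ψ ∈ Q, B (t.1 ψ) = 0 := by
    intro t ψ hψ
    simp only [B, LinearMap.sub_apply, LinearMap.id_apply]
    rw [hAfix t ψ hψ, sub_self]
  have hBadj : LinearMap.adjoint B = B := by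
    simp only [B, map_sub, map_sum]
    congr 1
    · simp
    · refine Finset.sum_congr rfl fun t _ => ?_
      simp only [A, LinearMap.adjoint_comp, LinearMap.adjoint_adjoint, hPadj',
        LinearMap.comp_assoc]
  have hBB : B ∘ₗ B = B := by
    have h0 : ∀ φ, B ((∑ t, A t) φ) = 0 := by
      intro φ
      rw [LinearMap.sum_apply, map_sum]
      exact Finset.sum_eq_zero fun t _ => hBzero t _ (hPmem _)
    ext1 ψ
    have : B ψ = ψ - (∑ t, A t) ψ := rfl
    rw [LinearMap.comp_apply]
    conv_lhs => rw [this, map_sub, h0, sub_zero]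
  let R : Option T → (QubitSpace ι →ₗ[ℂ] QubitSpace ι) := fun o =>
    o.elim B fun t => P ∘ₗ LinearMap.adjoint t.1
  let σ := (Fintype.equivFin (Option T)).symm
  refine ⟨Fintype.card (Option T), fun j => R (σ j), ?_, ?_⟩
  · rw [σ.sum_comp fun o => LinearMap.adjoint (R o) ∘ₗ R o, Fintype.sum_option]
    simp only [R, Option.elim, hA, hBadj, hBB]
    simp [B]
  · intro e he j
    obtain ⟨t, ht, c, hc⟩ := hrep e he
    generalize hσ : σ j = o
    cases o with
    | none =>
      refine ⟨0, fun ψ hψ => ?_⟩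
      simp only [R, hσ, Option.elim]
      rw [hc ψ hψ, map_smul, hBzero ⟨t, ht⟩ ψ hψ, smul_zero, zero_smul]
    | some s =>
      by_cases hst : s.1 = t
      · refine ⟨c, fun ψ hψ => ?_⟩
        simp only [R, hσ, Option.elim, LinearMap.comp_apply]
        rw [hc ψ hψ, map_smul, map_smul, hst, hself t ht ψ hψ]
      · refine ⟨0, fun ψ hψ => ?_⟩
        simp only [R, hσ, Option.elim, LinearMap.comp_apply]
        rw [hc ψ hψ, map_smul, map_smul, hcross s.1 s.2 t ht hst ψ hψ, smul_zero, zero_smul]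

end Recovery

/-! ### The code of a tessellation: error correction and dimension. -/

namespace Tessellation

variable (T : Tessellation)

lemma range_boundary₂ :
    LinearMap.range T.boundary₂ = Submodule.span (ZMod 2) (Set.range T.faceChain) :=
  Finsupp.range_linearCombination _

variable [Fintype T.E]

lemma boundary₁_apply (c : T.E → ZMod 2) (v : T.V) : T.boundary₁ c v = T.starChain v ⬝ᵥ c := rfl

instance : Fintype T.dual.E := inferInstanceAs (Fintype T.E)

lemma pauliX_of_mem_code {ψ : QubitSpace T.E} (hψ : ψ ∈ T.code) {a : T.E → ZMod 2}
    (ha : a ∈ LinearMap.range T.boundary₂) : pauliX a ψ = ψ := by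
  rw [range_boundary₂] at ha
  refine pauliX_fixed_of_mem_span ?_ ha
  rintro _ ⟨f, rfl⟩
  exact hψ.1 f

lemma pauliZ_of_mem_code {ψ : QubitSpace T.E} (hψ : ψ ∈ T.code) {b : T.E → ZMod 2}
    (hb : b ∈ LinearMap.range T.dual.boundary₂) : pauliZ b ψ = ψ := by
  rw [range_boundary₂] at hb
  refine pauliZ_fixed_of_mem_span ?_ hb
  rintro _ ⟨v, rfl⟩
  exact hψ.2 v

/-- The code of a tessellation corrects all errors that are shorter than half of the shortest
nontrivial cycles of the tessellation (bit flips) and of its dual (phase shifts). -/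
theorem corrects_code {dx dz : ℕ} (hdx : 0 < dx) (hdz : 0 < dz)
    (hx : ∀ w ∈ T.nontrivialCycleLengths, dx ≤ w)
    (hz : ∀ w ∈ T.dual.nontrivialCycleLengths, dz ≤ w) :
    Corrects T.code {e | ∃ a b : T.E → ZMod 2,
      weight a ≤ (dx - 1) / 2 ∧ weight b ≤ (dz - 1) / 2 ∧ e = pauliX a ∘ₗ pauliZ b} := by
  classical
  apply corrects_of_proportional_or_orthogonal
  · refine (Set.finite_range fun p : (T.E → ZMod 2) × (T.E → ZMod 2) =>
      pauliX p.1 ∘ₗ pauliZ p.2).subset ?_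
    rintro _ ⟨a, b, -, -, rfl⟩
    exact ⟨(a, b), rfl⟩
  · rintro _ ⟨a, b, -, -, rfl⟩ φ ψ
    rw [LinearMap.comp_apply, LinearMap.comp_apply]
    convert (inner_pauliX a _ _).trans (inner_pauliZ b φ ψ)
  · rintro _ ⟨a, b, ha, hb, rfl⟩ _ ⟨a', b', ha', hb', rfl⟩
    simp only [LinearMap.comp_apply]
    by_cases hA : a + a' ∈ LinearMap.ker T.boundary₁
    · by_cases hB : b + b' ∈ LinearMap.ker T.dual.boundary₁
      · left
        -- A cycle of weight at most `2 * ((dx - 1) / 2) < dx` is too short to be nontrivial.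
        have hA' : a + a' ∈ LinearMap.range T.boundary₂ := by
          by_contra hn
          have := hx _ ⟨a + a', hA, hn, rfl⟩
          have := weight_add_le a a'
          omega
        have hB' : b + b' ∈ LinearMap.range T.dual.boundary₂ := by
          by_contra hn
          have h : dz ≤ weight (ι := T.E) (b + b') := hz _ ⟨b + b', hB, hn, rfl⟩
          have := weight_add_le b b'
          omega
        refine ⟨sign (b ⬝ᵥ (a + a')), fun ψ hψ => ?_⟩
        have h1 : pauliZ b' ψ = pauliZ b ψ := by
          conv_rhs => rw [← T.pauliZ_of_mem_code hψ hB', pauliZ_pauliZ, ← add_assoc,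
            chain_add_self, zero_add]
        have h2 : pauliX a' (pauliZ b ψ) = pauliX a (pauliX (a + a') (pauliZ b ψ)) := by
          rw [pauliX_pauliX, ← add_assoc, chain_add_self, zero_add]
        rw [h1, h2, pauliX_pauliZ, T.pauliX_of_mem_code hψ hA', map_smul]
      · right
        intro φ hφ ψ hψ
        -- The face operator at `f` acts on the two images of the code by opposite signs. As it is
        -- an isometry, they are orthogonal.
        obtain ⟨f, hf⟩ : ∃ f, T.faceChain f ⬝ᵥ (b + b') ≠ 0 := by
          by_contra! hcon
          exact hB (funext hcon)
        have hX : ∀ a b : T.E → ZMod 2, ∀ ψ ∈ T.code, pauliX (T.faceChain f)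
            (pauliX a (pauliZ b ψ)) = sign (b ⬝ᵥ T.faceChain f) • pauliX a (pauliZ b ψ) := by
          intro a b ψ hψ
          rw [pauliX_pauliX, add_comm, ← pauliX_pauliX, pauliX_pauliZ, hψ.1 f, map_smul]
        have key := inner_pauliX (T.faceChain f) (pauliX a (pauliZ b φ)) (pauliX a' (pauliZ b' ψ))
        rw [hX _ _ φ hφ, hX _ _ ψ hψ, inner_smul_left, inner_smul_right, conj_sign, ← mul_assoc,
          ← sign_add, ← add_dotProduct, dotProduct_comm] at key
        have h1 : T.faceChain f ⬝ᵥ (b + b') = 1 := zmod_two_eq_one_of_ne_zero hf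
        rw [h1, sign_one] at key
        have h2 : (2 : ℂ) * inner ℂ (pauliX a (pauliZ b φ)) (pauliX a' (pauliZ b' ψ)) = 0 := by
          linear_combination -key
        simpa using h2
    · right
      intro φ hφ ψ hψ
      obtain ⟨v, hv⟩ : ∃ v, T.starChain v ⬝ᵥ (a + a') ≠ 0 := by
        by_contra! hcon
        exact hA (funext hcon)
      have hZ : ∀ a b : T.E → ZMod 2, ∀ ψ ∈ T.code, pauliZ (T.starChain v)
          (pauliX a (pauliZ b ψ)) = sign (T.starChain v ⬝ᵥ a) • pauliX a (pauliZ b ψ) := by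
        intro a b ψ hψ
        rw [pauliZ_pauliX, pauliZ_pauliZ, add_comm, ← pauliZ_pauliZ, hψ.2 v]
      have key := inner_pauliZ (T.starChain v) (pauliX a (pauliZ b φ)) (pauliX a' (pauliZ b' ψ))
      rw [hZ _ _ φ hφ, hZ _ _ ψ hψ, inner_smul_left, inner_smul_right, conj_sign, ← mul_assoc,
        ← sign_add, ← dotProduct_add] at key
      have h1 : T.starChain v ⬝ᵥ (a + a') = 1 := zmod_two_eq_one_of_ne_zero hv
      rw [h1, sign_one] at key
      have h2 : (2 : ℂ) * inner ℂ (pauliX a (pauliZ b φ)) (pauliX a' (pauliZ b' ψ)) = 0 := by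
        linear_combination -key
      simpa using h2

open Classical in
/-- The state with amplitude `F [c]` on the cycles `c` of homology class `[c]` and amplitude zero
elsewhere. -/
def homologyState :
    ((LinearMap.ker T.boundary₁ ⧸
      (LinearMap.range T.boundary₂).comap (LinearMap.ker T.boundary₁).subtype) → ℂ) →ₗ[ℂ]
      QubitSpace T.E where
  toFun F := WithLp.toLp 2 fun x =>
    if hx : x ∈ LinearMap.ker T.boundary₁ then F (Submodule.Quotient.mk ⟨x, hx⟩) else 0
  map_add' F G := by
    ext x
    by_cases hx : T.boundary₁ x = 0 <;> simp [hx]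
  map_smul' r F := by
    ext x
    by_cases hx : T.boundary₁ x = 0 <;> simp [hx]

lemma homologyState_apply_of_mem (F) {x : T.E → ZMod 2} (hx : x ∈ LinearMap.ker T.boundary₁) :
    T.homologyState F x = F (Submodule.Quotient.mk ⟨x, hx⟩) := dif_pos hx

lemma homologyState_apply_of_not_mem (F) {x : T.E → ZMod 2}
    (hx : x ∉ LinearMap.ker T.boundary₁) : T.homologyState F x = 0 := dif_neg hx

lemma homologyState_injective : Function.Injective T.homologyState := by
  intro F G h
  funext q
  obtain ⟨⟨x, hx⟩, rfl⟩ := Submodule.Quotient.mk_surjective _ q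
  rw [← T.homologyState_apply_of_mem F, h, T.homologyState_apply_of_mem]

/-- Vertex operators force the amplitude to vanish off the cycles, and face operators make it
invariant under adding boundaries. So the states of the code are the functions on the first
homology. -/
lemma range_homologyState (hle : LinearMap.range T.boundary₂ ≤ LinearMap.ker T.boundary₁) :
    LinearMap.range T.homologyState = T.code := by
  apply le_antisymm
  · rintro _ ⟨F, rfl⟩
    refine ⟨fun f => ?_, fun v => ?_⟩
    · have hf : T.faceChain f ∈ LinearMap.range T.boundary₂ := by
        rw [range_boundary₂]
        exact Submodule.subset_span ⟨f, rfl⟩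
      ext x
      rw [pauliX_apply]
      by_cases hx : x ∈ LinearMap.ker T.boundary₁
      · rw [T.homologyState_apply_of_mem F hx,
          T.homologyState_apply_of_mem F (Submodule.sub_mem _ hx (hle hf))]
        congr 1
        rw [Submodule.Quotient.eq]
        simpa using hf
      · rw [T.homologyState_apply_of_not_mem F hx, T.homologyState_apply_of_not_mem F]
        intro h
        exact hx (by simpa using Submodule.add_mem _ h (hle hf))
    · ext x
      rw [pauliZ_apply]
      by_cases hx : x ∈ LinearMap.ker T.boundary₁
      · rw [← boundary₁_apply, LinearMap.mem_ker.1 hx, Pi.zero_apply, sign_zero, one_mul]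
      · rw [T.homologyState_apply_of_not_mem F hx, mul_zero]
  · intro ψ hψ
    refine ⟨fun q => ψ (Quotient.out q : LinearMap.ker T.boundary₁), ?_⟩
    ext x
    by_cases hx : x ∈ LinearMap.ker T.boundary₁
    · rw [T.homologyState_apply_of_mem _ hx]
      set y := Quotient.out (Submodule.Quotient.mk (p := (LinearMap.range T.boundary₂).comap
        (LinearMap.ker T.boundary₁).subtype) (⟨x, hx⟩ : LinearMap.ker T.boundary₁)) with hy
      have hq : Submodule.Quotient.mk (p := (LinearMap.range T.boundary₂).comap
        (LinearMap.ker T.boundary₁).subtype) y = Submodule.Quotient.mk ⟨x, hx⟩ :=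
        Quotient.out_eq _
      rw [Submodule.Quotient.eq] at hq
      have h := T.pauliX_of_mem_code hψ hq
      conv_lhs => rw [← h, pauliX_apply]
      simp
    · rw [T.homologyState_apply_of_not_mem _ hx]
      obtain ⟨v, hv⟩ : ∃ v, T.starChain v ⬝ᵥ x ≠ 0 := by
        by_contra! hcon
        exact hx (funext hcon)
      have h1 : T.starChain v ⬝ᵥ x = 1 := zmod_two_eq_one_of_ne_zero hv
      have h := congrArg (fun φ : QubitSpace T.E => φ x) (hψ.2 v)
      simp only [pauliZ_apply, h1, sign_one] at h
      have h2 : (2 : ℂ) * ψ x = 0 := by linear_combination -h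
      exact (by simpa using h2 : ψ x = 0).symm

/-- The dimension of the code of a tessellation is `2 ^ k`, where `k` is the dimension of the
first homology over `ZMod 2`. -/
theorem finrank_code (hle : LinearMap.range T.boundary₂ ≤ LinearMap.ker T.boundary₁) {k : ℕ}
    (hk : Module.finrank (ZMod 2) (LinearMap.ker T.boundary₁) =
      Module.finrank (ZMod 2) (LinearMap.range T.boundary₂) + k) :
    Module.finrank ℂ T.code = 2 ^ k := by
  classical
  rw [← T.range_homologyState hle, LinearMap.finrank_range_of_inj T.homologyState_injective]
  have : Fintype (LinearMap.ker T.boundary₁ ⧸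
      (LinearMap.range T.boundary₂).comap (LinearMap.ker T.boundary₁).subtype) :=
    Fintype.ofFinite _
  rw [Module.finrank_fintype_fun_eq_card, Module.card_eq_pow_finrank (K := ZMod 2), ZMod.card]
  congr 1
  have h1 := Submodule.finrank_quotient_add_finrank
    ((LinearMap.range T.boundary₂).comap (LinearMap.ker T.boundary₁).subtype)
  have h2 := (Submodule.comapSubtypeEquivOfLe hle).finrank_eq
  omega

end Tessellation

/-! ### Cycles, holonomy and path lifting in multigraphs. -/

section Multigraph

open scoped Classical

variable {V E : Type*}

/-- The `ZMod 2`-chain `p + q` of two vertices. -/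
def ends (p q : V) : V → ZMod 2 := Pi.single p 1 + Pi.single q 1

lemma ends_comm (p q : V) : ends p q = ends q p := add_comm _ _

lemma ends_self (p : V) : ends p p = 0 := by
  funext v
  exact CharTwo.add_self_eq_zero _

lemma ends_add_ends (p q r : V) : ends p q + ends q r = ends p r := by
  have h : Pi.single q 1 + Pi.single q 1 = (0 : V → ZMod 2) := ends_self q
  unfold ends
  calc _ = Pi.single p 1 + (Pi.single q 1 + Pi.single q 1) + Pi.single r (1 : ZMod 2) := by abel
    _ = _ := by rw [h, add_zero]

lemma ends_apply_left {p q : V} (h : p ≠ q) : ends p q p = 1 := by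
  simp [ends, h]

lemma ends_apply_right {p q : V} (h : p ≠ q) : ends p q q = 1 := by
  simp [ends, h.symm]

lemma ends_apply_of_ne {p q v : V} (h : v ≠ p) (h' : v ≠ q) : ends p q v = 0 := by
  simp [ends, h, h']

/-- The reduction of the period lattice `ℤ × ℤ` modulo two. -/
def mod2 : ℤ × ℤ →+ ZMod 2 × ZMod 2 :=
  (Int.castAddHom (ZMod 2)).prodMap (Int.castAddHom (ZMod 2))

lemma mod2_neg (t : ℤ × ℤ) : mod2 (-t) = mod2 t := by
  rw [map_neg]
  generalize mod2 t = s
  revert s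
  decide

variable {W : Type*} [SeminormedAddCommGroup W] (src tgt : E → V) (hol : E → ℤ × ℤ)
  (emb : ℤ × ℤ →+ W) (pos : V → W) {r : ℝ}

/-- A set of edges with a boundary point `p` contains a path from `p` to another boundary point.
The path lifts to a path in the covering space `W` whose end is displaced by a period `t` from the
chosen lift of the end point. -/
lemma exists_subpath (hne : ∀ e, src e ≠ tgt e)
    (hstep : ∀ e, ‖pos (tgt e) + emb (hol e) - pos (src e)‖ ≤ r) (n : ℕ) :
    ∀ S : Finset E, S.card = n → ∀ p : V, (∑ e ∈ S, ends (src e) (tgt e)) p ≠ 0 →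
      ∃ q, q ≠ p ∧ (∑ e ∈ S, ends (src e) (tgt e)) q ≠ 0 ∧ ∃ D ⊆ S,
        ∑ e ∈ D, ends (src e) (tgt e) = ends p q ∧
        ∃ t, ∑ e ∈ D, mod2 (hol e) = mod2 t ∧ ‖pos q + emb t - pos p‖ ≤ D.card * r := by
  induction n with
  | zero =>
    intro S hS p hp
    rw [Finset.card_eq_zero.1 hS] at hp
    simp at hp
  | succ n ih =>
    intro S hS p hp
    obtain ⟨e, heS, hep⟩ : ∃ e ∈ S, ends (src e) (tgt e) p ≠ 0 := by
      by_contra! hcon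
      exact hp (by rw [Finset.sum_apply, Finset.sum_eq_zero hcon])
    obtain ⟨p', hpp', hend, s, hs, hnorm⟩ : ∃ p', p ≠ p' ∧ ends (src e) (tgt e) = ends p p' ∧
        ∃ s, mod2 (hol e) = mod2 s ∧ ‖pos p' + emb s - pos p‖ ≤ r := by
      by_cases h1 : p = src e
      · subst h1
        exact ⟨tgt e, hne e, rfl, hol e, rfl, hstep e⟩
      · by_cases h2 : p = tgt e
        · subst h2
          refine ⟨src e, (hne e).symm, ends_comm _ _, -hol e, (mod2_neg _).symm, ?_⟩
          have heq : pos (src e) + emb (-hol e) - pos (tgt e) =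
              -(pos (tgt e) + emb (hol e) - pos (src e)) := by
            rw [map_neg]
            abel
          rw [heq, norm_neg]
          exact hstep e
        · exact absurd (ends_apply_of_ne h1 h2) hep
    have hsum : ends p p' + ∑ e ∈ S.erase e, ends (src e) (tgt e) =
        ∑ e ∈ S, ends (src e) (tgt e) := by
      rw [← hend]
      exact Finset.add_sum_erase S (fun e => ends (src e) (tgt e)) heS
    -- If `p'` is not a boundary point of `S`, it becomes one when `e` is removed, and the path
    -- continues from there. By the same removal `p` ceases to be one, so the path cannot end at
    -- `p`. Otherwise the path stops at `p'`.
    by_cases hp' : (∑ e ∈ S, ends (src e) (tgt e)) p' = 0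
    · have hp1 := zmod_two_eq_one_of_ne_zero hp
      rw [← hsum] at hp' hp1
      rw [Pi.add_apply, ends_apply_right hpp'] at hp'
      rw [Pi.add_apply, ends_apply_left hpp'] at hp1
      obtain ⟨q, hq, hqS, D, hD, hDend, t, ht, htn⟩ := ih (S.erase e)
        (by rw [Finset.card_erase_of_mem heS, hS]; rfl) p' (by
          intro h
          simp [h] at hp')
      have hqp : q ≠ p := by
        rintro rfl
        exact hqS (by simpa using hp1)
      have heD : e ∉ D := fun h => (Finset.mem_erase.1 (hD h)).1 rfl
      refine ⟨q, hqp, ?_, insert e D, ?_, ?_, s + t, ?_, ?_⟩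
      · rw [← hsum, Pi.add_apply, ends_apply_of_ne hqp hq, zero_add]
        exact hqS
      · exact Finset.insert_subset heS (hD.trans (Finset.erase_subset _ _))
      · rw [Finset.sum_insert heD, hend, hDend, ends_add_ends]
      · rw [Finset.sum_insert heD, hs, ht, map_add]
      · rw [Finset.card_insert_of_notMem heD]
        have h := norm_add_le (pos p' + emb s - pos p) (pos q + emb t - pos p')
        have heq : pos q + emb (s + t) - pos p =
            pos p' + emb s - pos p + (pos q + emb t - pos p') := by
          rw [map_add]
          abel
        rw [heq]
        push_cast
        linarith
    · exact ⟨p', hpp'.symm, hp', {e}, by simpa using heS, by simpa using hend, s, by simpa using hs,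
        by simpa using hnorm⟩

/-- A cycle that is too short to connect a point of the covering space with another lift of the
same point has trivial holonomy modulo two. -/
lemma holonomy_eq_zero_of_short (hne : ∀ e, src e ≠ tgt e)
    (hstep : ∀ e, ‖pos (tgt e) + emb (hol e) - pos (src e)‖ ≤ r) {ρ : ℝ}
    (hρ : ∀ t, t ≠ 0 → ρ ≤ ‖emb t‖) (S : Finset E) (hS : ∑ e ∈ S, ends (src e) (tgt e) = 0)
    (hshort : S.card * r < ρ) : ∑ e ∈ S, mod2 (hol e) = 0 := by
  induction hn : S.card using Nat.strong_induction_on generalizing S with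
  | _ n ih =>
  subst hn
  rcases S.eq_empty_or_nonempty with rfl | ⟨e, heS⟩
  · simp
  have hr : 0 ≤ r := (norm_nonneg _).trans (hstep e)
  have hsum : ends (src e) (tgt e) + ∑ e ∈ S.erase e, ends (src e) (tgt e) = 0 :=
    (Finset.add_sum_erase S (fun e => ends (src e) (tgt e)) heS).trans hS
  have hS' : ∀ v, (∑ e ∈ S.erase e, ends (src e) (tgt e)) v = ends (src e) (tgt e) v := by
    intro v
    have h := congrFun hsum v
    exact (CharTwo.add_eq_zero.1 h).symm
  -- Once `e` is removed, its two ends are the only boundary points left. So a path that starts at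
  -- one must end at the other, and `e` closes it up.
  obtain ⟨q, hq, hqS, D, hD, hDend, t, ht, htn⟩ := exists_subpath src tgt hol emb pos hne hstep _
    (S.erase e) rfl (tgt e) (by
      rw [hS', ends_apply_right (hne e)]
      exact one_ne_zero)
  have hqs : q = src e := by
    by_contra h
    exact hqS (by rw [hS', ends_apply_of_ne h hq])
  subst hqs
  have heD : e ∉ D := fun h => (Finset.mem_erase.1 (hD h)).1 rfl
  have hsub : insert e D ⊆ S := Finset.insert_subset heS (hD.trans (Finset.erase_subset _ _))
  have hcard : D.card + 1 ≤ S.card := by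
    rw [← Finset.card_insert_of_notMem heD]
    exact Finset.card_le_card hsub
  -- The closed walk `insert e D` lifts to a path whose ends differ by the period `hol e + t`. Its
  -- length is less than `ρ`, so the period is zero; the rest of `S` is a shorter cycle.
  have ht0 : hol e + t = 0 := by
    by_contra h
    have h1 := hρ _ h
    have h2 := norm_add_le (pos (tgt e) + emb (hol e) - pos (src e))
      (pos (src e) + emb t - pos (tgt e))
    have heq : pos (tgt e) + emb (hol e) - pos (src e) + (pos (src e) + emb t - pos (tgt e)) =
        emb (hol e + t) := by
      rw [map_add]
      abel
    rw [heq] at h2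
    have h3 : ((D.card : ℝ) + 1) * r ≤ S.card * r :=
      mul_le_mul_of_nonneg_right (by exact_mod_cast hcard) hr
    have h4 := hstep e
    linarith
  have hhol : ∑ e ∈ insert e D, mod2 (hol e) = 0 := by
    rw [Finset.sum_insert heD, ht, ← map_add, ht0, map_zero]
  have hend : ∑ e ∈ insert e D, ends (src e) (tgt e) = 0 := by
    rw [Finset.sum_insert heD, hDend, ends_add_ends, ends_self]
  have hlt : (S \ insert e D).card < S.card := by
    rw [Finset.card_sdiff_of_subset hsub, Finset.card_insert_of_notMem heD]
    omega
  have hrec := ih _ hlt (S \ insert e D)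
    (by
      have h := Finset.sum_sdiff (f := fun e => ends (src e) (tgt e)) hsub
      rw [hend, add_zero] at h
      exact h.trans hS)
    (lt_of_le_of_lt (mul_le_mul_of_nonneg_right (by exact_mod_cast hlt.le) hr) hshort) rfl
  rw [← Finset.sum_sdiff hsub, hrec, hhol, add_zero]

variable [Fintype E]

lemma linearCombination_eq_sum_support {M : Type*} [AddCommGroup M] [Module (ZMod 2) M]
    (f : E → M) (c : E → ZMod 2) :
    Fintype.linearCombination (ZMod 2) f c = ∑ e ∈ Finset.univ.filter (fun e => c e ≠ 0), f e := by
  rw [Fintype.linearCombination_apply, Finset.sum_filter]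
  refine Finset.sum_congr rfl fun e _ => ?_
  split_ifs with h
  · rw [zmod_two_eq_one_of_ne_zero h, one_smul]
  · rw [not_not.1 h, zero_smul]

/-- The sum over the edges of a chain of the holonomies modulo two. -/
def holonomy : (E → ZMod 2) →ₗ[ZMod 2] ZMod 2 × ZMod 2 :=
  Fintype.linearCombination (ZMod 2) fun e => mod2 (hol e)

/-- The boundary operator of a multigraph over `ZMod 2`. -/
def graphBoundary : (E → ZMod 2) →ₗ[ZMod 2] (V → ZMod 2) :=
  Fintype.linearCombination (ZMod 2) fun e => ends (src e) (tgt e)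

/-- A cycle with nontrivial holonomy is at least as long as the shortest period. -/
theorem le_weight_of_holonomy_ne_zero (hne : ∀ e, src e ≠ tgt e)
    (hstep : ∀ e, ‖pos (tgt e) + emb (hol e) - pos (src e)‖ ≤ r) {ρ : ℝ}
    (hρ : ∀ t, t ≠ 0 → ρ ≤ ‖emb t‖) {c : E → ZMod 2} (hc : graphBoundary src tgt c = 0)
    (hhol : holonomy hol c ≠ 0) : ρ ≤ weight c * r := by
  by_contra! hlt
  rw [graphBoundary, linearCombination_eq_sum_support] at hc
  rw [holonomy, linearCombination_eq_sum_support] at hhol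
  refine hhol (holonomy_eq_zero_of_short src tgt hol emb pos hne hstep hρ _ hc ?_)
  simpa only [weight] using hlt

/-- There is a path of at most `n` edges from `p` to `q` with holonomy `τ`. -/
def Reach (p q : V) (n : ℕ) (τ : ZMod 2 × ZMod 2) : Prop :=
  ∃ d, graphBoundary src tgt d = ends p q ∧ weight d ≤ n ∧ holonomy hol d = τ

variable {src tgt hol}

lemma Reach.refl (p : V) : Reach src tgt hol p p 0 0 :=
  ⟨0, by rw [map_zero, ends_self], by simp [weight], map_zero _⟩

lemma Reach.trans {p q s : V} {n k : ℕ} {σ τ : ZMod 2 × ZMod 2}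
    (h : Reach src tgt hol p q n σ) (h' : Reach src tgt hol q s k τ) :
    Reach src tgt hol p s (n + k) (σ + τ) := by
  obtain ⟨d, h1, h2, h3⟩ := h
  obtain ⟨d', h1', h2', h3'⟩ := h'
  exact ⟨d + d', by rw [map_add, h1, h1', ends_add_ends],
    (weight_add_le d d').trans (add_le_add h2 h2'), by rw [map_add, h3, h3']⟩

lemma Reach.symm {p q : V} {n : ℕ} {τ : ZMod 2 × ZMod 2} (h : Reach src tgt hol p q n τ) :
    Reach src tgt hol q p n τ := by
  obtain ⟨d, h1, h2, h3⟩ := h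
  exact ⟨d, by rw [h1, ends_comm], h2, h3⟩

variable (src tgt hol) in
lemma Reach.edge (e : E) : Reach src tgt hol (src e) (tgt e) 1 (mod2 (hol e)) := by
  refine ⟨Pi.single e 1, ?_, ?_, ?_⟩
  · rw [graphBoundary, Fintype.linearCombination_apply_single, one_smul]
  · rw [weight, Finset.card_le_one]
    intro a ha b hb
    simp only [Finset.mem_filter, Finset.mem_univ, true_and, ne_eq, Pi.single_apply,
      ite_eq_right_iff, not_forall] at ha hb
    rw [ha.1, hb.1]
  · rw [holonomy, Fintype.linearCombination_apply_single, one_smul]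

/-- The boundary operator of a connected graph has corank one. -/
lemma finrank_range_graphBoundary [Fintype V] [Nonempty V]
    (hconn : ∀ p q, ∃ d, graphBoundary src tgt d = ends p q) :
    Module.finrank (ZMod 2) (LinearMap.range (graphBoundary src tgt)) + 1 = Fintype.card V := by
  let aug : (V → ZMod 2) →ₗ[ZMod 2] ZMod 2 := Fintype.linearCombination (ZMod 2) fun _ => 1
  have haug : ∀ p q, aug (ends p q) = 0 := by
    intro p q
    simp only [ends, aug, map_add, Fintype.linearCombination_apply_single]
    exact CharTwo.add_self_eq_zero _
  have hrange : LinearMap.range (graphBoundary src tgt) = LinearMap.ker aug := by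
    apply le_antisymm
    · rintro _ ⟨d, rfl⟩
      rw [LinearMap.mem_ker, graphBoundary, Fintype.linearCombination_apply (ZMod 2)
        (fun e => ends (src e) (tgt e)), map_sum]
      exact Finset.sum_eq_zero fun e _ => by rw [map_smul, haug, smul_zero]
    · intro f hf
      obtain ⟨v₀⟩ := ‹Nonempty V›
      have hf' : ∑ v, f v = 0 := by
        simpa [aug, Fintype.linearCombination_apply] using LinearMap.mem_ker.1 hf
      -- The contributions at `v₀` cancel because the coefficients of `f` sum to zero.
      have hsum : f = ∑ v, f v • ends v v₀ := by
        simp only [ends, smul_add, Finset.sum_add_distrib]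
        rw [← Finset.sum_smul, hf', zero_smul, add_zero]
        funext w
        simp [Finset.sum_apply, Pi.single_apply]
      rw [hsum]
      refine Submodule.sum_mem _ fun v _ => Submodule.smul_mem _ _ ?_
      obtain ⟨d, hd⟩ := hconn v v₀
      exact ⟨d, hd⟩
  have hsurj : LinearMap.range aug = ⊤ := by
    rw [LinearMap.range_eq_top]
    intro s
    obtain ⟨v₀⟩ := ‹Nonempty V›
    refine ⟨Pi.single v₀ s, ?_⟩
    rw [Fintype.linearCombination_apply_single, smul_eq_mul, mul_one]
  have h := LinearMap.finrank_range_add_finrank_ker aug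
  rw [hsurj, finrank_top, Module.finrank_self, Module.finrank_fintype_fun_eq_card] at h
  rw [hrange]
  omega

end Multigraph

/-! ### Homology of tessellations and its invariance under isomorphism. -/

namespace Tessellation

variable (T : Tessellation)

lemma starChain_eq_ends {src tgt : T.E → T.V} (hne : ∀ e, src e ≠ tgt e)
    (hends : ∀ v e, T.endpoint v e ↔ v = src e ∨ v = tgt e) (v : T.V) (e : T.E) :
    T.starChain v e = ends (src e) (tgt e) v := by
  rw [starChain]
  by_cases h1 : v = src e
  · subst h1
    rw [if_pos ((hends _ _).2 (Or.inl rfl)), ends_apply_left (hne e)]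
  · by_cases h2 : v = tgt e
    · subst h2
      rw [if_pos ((hends _ _).2 (Or.inr rfl)), ends_apply_right (hne e)]
    · rw [if_neg (by rw [hends]; tauto), ends_apply_of_ne h1 h2]

section

variable [Fintype T.E]

lemma boundary₁_eq_graphBoundary {src tgt : T.E → T.V} (hne : ∀ e, src e ≠ tgt e)
    (hends : ∀ v e, T.endpoint v e ↔ v = src e ∨ v = tgt e) :
    T.boundary₁ = graphBoundary src tgt := by
  refine LinearMap.ext fun c => funext fun v => ?_
  rw [boundary₁_apply, graphBoundary, Fintype.linearCombination_apply, Finset.sum_apply]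
  refine Finset.sum_congr rfl fun e _ => ?_
  rw [Pi.smul_apply, smul_eq_mul, mul_comm, T.starChain_eq_ends hne hends]

/-- Row rank equals column rank for the face-edge incidence matrix: its rows span the boundaries,
and multiplication by it is the boundary operator of the dual. -/
lemma finrank_range_boundary₂ [Fintype T.F] :
    Module.finrank (ZMod 2) (LinearMap.range T.boundary₂) =
      Module.finrank (ZMod 2) (LinearMap.range T.dual.boundary₁) := by
  let M : Matrix T.F T.E (ZMod 2) := Matrix.of T.faceChain
  have h : T.dual.boundary₁ = M.mulVecLin := rfl
  rw [h, range_boundary₂]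
  exact M.rank_eq_finrank_span_row.symm

/-- If the first homology has the same dimension as the space of holonomies, and the holonomy is
onto, then it detects the nontrivial cycles. -/
lemma mem_range_boundary₂_iff {H : (T.E → ZMod 2) →ₗ[ZMod 2] ZMod 2 × ZMod 2}
    (hface : ∀ f, H (T.faceChain f) = 0)
    (hle : LinearMap.range T.boundary₂ ≤ LinearMap.ker T.boundary₁)
    (hdim : Module.finrank (ZMod 2) (LinearMap.ker T.boundary₁) =
      Module.finrank (ZMod 2) (LinearMap.range T.boundary₂) + 2)
    (hsurj : ∀ τ, ∃ c, T.boundary₁ c = 0 ∧ H c = τ) {c : T.E → ZMod 2}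
    (hc : T.boundary₁ c = 0) : c ∈ LinearMap.range T.boundary₂ ↔ H c = 0 := by
  have hB : LinearMap.range T.boundary₂ ≤ LinearMap.ker H := by
    rw [range_boundary₂, Submodule.span_le]
    rintro _ ⟨f, rfl⟩
    exact hface f
  refine ⟨fun h => hB h, fun h => ?_⟩
  let K := LinearMap.ker T.boundary₁
  have h1 := LinearMap.finrank_range_add_finrank_ker (H.domRestrict K)
  have h2 : LinearMap.range (H.domRestrict K) = ⊤ := by
    rw [LinearMap.range_eq_top]
    intro τ
    obtain ⟨d, hd, hdτ⟩ := hsurj τ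
    exact ⟨⟨d, hd⟩, hdτ⟩
  rw [h2, finrank_top, Module.finrank_prod, Module.finrank_self] at h1
  have h3 := (Submodule.comapSubtypeEquivOfLe hle).finrank_eq
  -- Boundaries lie in the kernel of `H` on cycles, and both subspaces have codimension two in the
  -- cycles.
  have h4 : (LinearMap.range T.boundary₂).comap K.subtype = LinearMap.ker (H.domRestrict K) := by
    apply Submodule.eq_of_le_of_finrank_eq
    · intro x hx
      exact hB hx
    · change Module.finrank (ZMod 2) (Submodule.comap K.subtype _) = _ at h3
      change Module.finrank (ZMod 2) K = _ at hdim
      omega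
  have h5 : (⟨c, hc⟩ : K) ∈ LinearMap.ker (H.domRestrict K) := h
  rw [← h4] at h5
  exact h5

end

/-- Isomorphisms of tessellations. -/
structure Iso (T T' : Tessellation) where
  onV : T.V ≃ T'.V
  onE : T.E ≃ T'.E
  onF : T.F ≃ T'.F
  endpoint_iff : ∀ v e, T'.endpoint (onV v) (onE e) ↔ T.endpoint v e
  border_iff : ∀ e f, T'.border (onE e) (onF f) ↔ T.border e f

namespace Iso

variable {T} {T' : Tessellation} (i : Iso T T')

/-- The dual isomorphism. -/
def dual : Iso T.dual T'.dual where
  onV := i.onF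
  onE := i.onE
  onF := i.onV
  endpoint_iff f e := i.border_iff e f
  border_iff e v := i.endpoint_iff v e

/-- The pullback of chains along an isomorphism. -/
def pullback : (T'.E → ZMod 2) ≃ₗ[ZMod 2] (T.E → ZMod 2) :=
  LinearEquiv.funCongrLeft (ZMod 2) (ZMod 2) i.onE

lemma pullback_faceChain (f : T.F) : i.pullback (T'.faceChain (i.onF f)) = T.faceChain f := by
  funext e
  change T'.faceChain (i.onF f) (i.onE e) = _
  classical exact if_congr (i.border_iff e f) rfl rfl

lemma map_range_boundary₂ :
    (LinearMap.range T'.boundary₂).map i.pullback.toLinearMap = LinearMap.range T.boundary₂ := by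
  rw [range_boundary₂, range_boundary₂, Submodule.map_span, ← Set.range_comp]
  congr 1
  rw [← i.onF.surjective.range_comp]
  congr 1
  funext f
  exact i.pullback_faceChain f

lemma pullback_mem_range_iff (c : T'.E → ZMod 2) :
    i.pullback c ∈ LinearMap.range T.boundary₂ ↔ c ∈ LinearMap.range T'.boundary₂ := by
  rw [← i.map_range_boundary₂]
  exact Function.Injective.mem_set_image i.pullback.injective

lemma finrank_range_boundary₂_eq (i : Iso T T') :
    Module.finrank (ZMod 2) (LinearMap.range T.boundary₂) =
    Module.finrank (ZMod 2) (LinearMap.range T'.boundary₂) := by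
  rw [← i.map_range_boundary₂]
  exact LinearEquiv.finrank_map_eq _ _

variable [Fintype T.E] [Fintype T'.E]

lemma boundary₁_pullback (c : T'.E → ZMod 2) (v : T.V) :
    T.boundary₁ (i.pullback c) v = T'.boundary₁ c (i.onV v) := by
  rw [boundary₁_apply, boundary₁_apply, dotProduct, dotProduct, ← i.onE.sum_comp]
  refine Finset.sum_congr rfl fun e _ => ?_
  have h : T.starChain v e = T'.starChain (i.onV v) (i.onE e) :=
    by classical exact if_congr (i.endpoint_iff v e).symm rfl rfl
  rw [h]
  rfl

lemma pullback_mem_ker_iff (c : T'.E → ZMod 2) :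
    i.pullback c ∈ LinearMap.ker T.boundary₁ ↔ c ∈ LinearMap.ker T'.boundary₁ := by
  rw [LinearMap.mem_ker, LinearMap.mem_ker, funext_iff, funext_iff, ← i.onV.forall_congr_right]
  simp [i.boundary₁_pullback]

lemma weight_pullback (c : T'.E → ZMod 2) : weight (i.pullback c) = weight c :=
  Finset.card_equiv i.onE fun e => by
    simp only [Finset.mem_filter, Finset.mem_univ, true_and]
    rfl

lemma nontrivialCycleLengths_eq (i : Iso T T') :
    T.nontrivialCycleLengths = T'.nontrivialCycleLengths := by
  ext w
  constructor
  · rintro ⟨c, h1, h2, h3⟩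
    obtain ⟨c, rfl⟩ := i.pullback.surjective c
    exact ⟨c, (i.pullback_mem_ker_iff c).1 h1, fun h => h2 ((i.pullback_mem_range_iff c).2 h),
      by rw [← h3, i.weight_pullback]⟩
  · rintro ⟨c, h1, h2, h3⟩
    exact ⟨i.pullback c, (i.pullback_mem_ker_iff c).2 h1,
      fun h => h2 ((i.pullback_mem_range_iff c).1 h), by rw [← h3, i.weight_pullback]⟩

lemma map_ker_boundary₁ :
    (LinearMap.ker T'.boundary₁).map i.pullback.toLinearMap = LinearMap.ker T.boundary₁ := by
  ext c
  obtain ⟨c, rfl⟩ := i.pullback.surjective c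
  rw [i.pullback_mem_ker_iff]
  exact Function.Injective.mem_set_image i.pullback.injective

lemma finrank_ker_boundary₁_eq (i : Iso T T') :
    Module.finrank (ZMod 2) (LinearMap.ker T.boundary₁) =
    Module.finrank (ZMod 2) (LinearMap.ker T'.boundary₁) := by
  rw [← i.map_ker_boundary₁]
  exact LinearEquiv.finrank_map_eq _ _

lemma range_le_ker_iff (i : Iso T T') : LinearMap.range T.boundary₂ ≤ LinearMap.ker T.boundary₁ ↔
    LinearMap.range T'.boundary₂ ≤ LinearMap.ker T'.boundary₁ := by
  rw [← i.map_ker_boundary₁, ← i.map_range_boundary₂]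
  exact Submodule.map_le_map_iff_of_injective i.pullback.injective _ _

end Iso

end Tessellation

/-! ### The lattice modulo its periods, and walks on the quotient. -/

section Periods

variable (φ : ℤ × ℤ →+ ℤ × ℤ)

/-- The lattice `ℤ × ℤ` modulo the periods `φ (i, j)`. -/
abbrev Cells : Type := (ℤ × ℤ) ⧸ φ.range

/-- The quotient map. -/
abbrev cell : ℤ × ℤ →+ Cells φ := QuotientAddGroup.mk' φ.range

variable {φ}

lemma cell_out (a : Cells φ) : cell φ (Quotient.out a) = a := Quotient.out_eq a

lemma cell_period (k : ℤ × ℤ) : cell φ (φ k) = 0 :=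
  (QuotientAddGroup.eq_zero_iff _).2 ⟨k, rfl⟩

lemma exists_period (a : Cells φ) (t : ℤ × ℤ) :
    ∃ k, φ k = Quotient.out a + t - Quotient.out (a + cell φ t) := by
  have h : cell φ (Quotient.out a + t - Quotient.out (a + cell φ t)) = 0 := by
    rw [map_sub, map_add, cell_out, cell_out, sub_self]
  exact (QuotientAddGroup.eq_zero_iff _).1 h

/-- The period by which the translate by `t` of the representative of `a` differs from the
representative of its class. -/
def period (a : Cells φ) (t : ℤ × ℤ) : ℤ × ℤ := (exists_period a t).choose

lemma period_spec (a : Cells φ) (t : ℤ × ℤ) :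
    φ (period a t) = Quotient.out a + t - Quotient.out (a + cell φ t) :=
  (exists_period a t).choose_spec

/-- The cocycle identity: periods add along consecutive displacements. Injectivity of `φ` makes the
period unique. -/
lemma period_add (hφ : Function.Injective φ) (a : Cells φ) (s t : ℤ × ℤ) :
    period a (s + t) = period a s + period (a + cell φ s) t := by
  apply hφ
  rw [map_add, period_spec, period_spec, period_spec, map_add, add_assoc a]
  abel

lemma period_zero (hφ : Function.Injective φ) (a : Cells φ) : period a 0 = 0 := by
  apply hφ
  rw [period_spec, map_zero, map_zero, add_zero, add_zero, sub_self]

/-- This gives cycles of any prescribed holonomy: walking by `φ k` returns to the same cell with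
period `k`. -/
lemma period_apply (hφ : Function.Injective φ) (a : Cells φ) (k : ℤ × ℤ) :
    period a (φ k) = k := by
  apply hφ
  rw [period_spec, cell_period, add_zero, add_sub_cancel_left]

lemma add_self_prod (s : ZMod 2 × ZMod 2) : s + s = 0 := by
  revert s
  decide

section Walks

variable {V E : Type*} [Fintype E] {src tgt : E → V} {hol : E → ℤ × ℤ} {v : Cells φ → V}

variable (src tgt hol v) in
/-- From every vertex `v a` there is a path of at most `n` edges that displaces it by `t`. -/
def Displaces (t : ℤ × ℤ) (n : ℕ) : Prop :=
  ∀ a, Reach src tgt hol (v a) (v (a + cell φ t)) n (mod2 (period a t))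

lemma Displaces.zero (hφ : Function.Injective φ) : Displaces src tgt hol v 0 0 := by
  intro a
  rw [map_zero, add_zero, period_zero hφ, map_zero]
  exact Reach.refl _

lemma Displaces.add (hφ : Function.Injective φ) {s t : ℤ × ℤ} {n k : ℕ}
    (hs : Displaces src tgt hol v s n) (ht : Displaces src tgt hol v t k) :
    Displaces src tgt hol v (s + t) (n + k) := by
  intro a
  rw [period_add hφ, map_add, map_add, ← add_assoc]
  exact (hs a).trans (ht _)

lemma Displaces.neg (hφ : Function.Injective φ) {t : ℤ × ℤ} {n : ℕ}
    (ht : Displaces src tgt hol v t n) : Displaces src tgt hol v (-t) n := by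
  intro a
  have h := ht (a + cell φ (-t))
  have h1 : period a (-t) + period (a + cell φ (-t)) t = 0 := by
    rw [← period_add hφ, neg_add_cancel, period_zero hφ]
  rw [add_assoc, ← map_add, neg_add_cancel, map_zero, add_zero] at h
  rw [eq_neg_of_add_eq_zero_left h1, mod2_neg]
  exact h.symm

lemma Displaces.nsmul (hφ : Function.Injective φ) {t : ℤ × ℤ}
    {n₀ : ℕ} (ht : Displaces src tgt hol v t n₀) (n : ℕ) :
    Displaces src tgt hol v (n • t) (n * n₀) := by
  induction n with
  | zero => simpa using Displaces.zero hφ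
  | succ n ih => simpa [add_smul, add_mul] using ih.add hφ ht

lemma Displaces.zsmul (hφ : Function.Injective φ) {t : ℤ × ℤ} {n₀ : ℕ}
    (ht : Displaces src tgt hol v t n₀) (n : ℤ) :
    Displaces src tgt hol v (n • t) (n.natAbs * n₀) := by
  rcases Int.natAbs_eq n with h | h
  · have := ht.nsmul hφ n.natAbs
    rwa [← natCast_zsmul, ← h] at this
  · have := (ht.nsmul hφ n.natAbs).neg hφ
    rwa [← natCast_zsmul, ← neg_zsmul, ← h] at this

end Walks

end Periods

/-! ### The hexagonal torus in lattice coordinates. -/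

section Model

open scoped Classical

/-- The translation from a hexagon to a neighbour. -/
def stepX : ℤ × ℤ := (1, 0)

/-- The translation from a hexagon to another neighbour, next to `stepX`. -/
def stepY : ℤ × ℤ := (1, -1)

/-- The hexagons at the ends of the edges `(0, k)` towards odd vertices. -/
def tgtOffset : Fin 3 → ℤ × ℤ := ![0, stepY - stepX, stepY]

/-- The hexagons on the left of the edges `(0, k)`. -/
def leftOffset : Fin 3 → ℤ × ℤ := ![0, 0, stepY]

/-- The hexagons on the right of the edges `(0, k)`. -/
def rightOffset : Fin 3 → ℤ × ℤ := ![stepX, stepY, stepX]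

variable (φ : ℤ × ℤ →+ ℤ × ℤ)

/-- The even end of an edge. -/
def srcVertex (e : Cells φ × Fin 3) : Cells φ × Bool := (e.1, false)

/-- The odd end of an edge. -/
def tgtVertex (e : Cells φ × Fin 3) : Cells φ × Bool := (e.1 + cell φ (tgtOffset e.2), true)

/-- The hexagon on the left of an edge. -/
def leftFace (e : Cells φ × Fin 3) : Cells φ := e.1 + cell φ (leftOffset e.2)

/-- The hexagon on the right of an edge. -/
def rightFace (e : Cells φ × Fin 3) : Cells φ := e.1 + cell φ (rightOffset e.2)

/-- The hexagonal tessellation of the torus in lattice coordinates. The hexagons are the elements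
`a` of `Cells φ`; each of them owns two of its vertices, one even and one odd, and the three
edges at its even vertex. -/
def hexModel : Tessellation where
  V := Cells φ × Bool
  E := Cells φ × Fin 3
  F := Cells φ
  endpoint v e := v = srcVertex φ e ∨ v = tgtVertex φ e
  border e f := f = leftFace φ e ∨ f = rightFace φ e

/-- The holonomy of the edges. -/
def edgeHol (e : Cells φ × Fin 3) : ℤ × ℤ := period e.1 (tgtOffset e.2)

/-- The holonomy of the dual edges. -/
def dualHol (e : Cells φ × Fin 3) : ℤ × ℤ :=
  period (leftFace φ e) (rightOffset e.2 - leftOffset e.2)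

lemma src_ne_tgt (e : Cells φ × Fin 3) : srcVertex φ e ≠ tgtVertex φ e :=
  fun h => Bool.noConfusion (congrArg Prod.snd h)

/-- No two neighbours among the hexagons `0`, `stepX` and `stepY` are equal on the torus. -/
structure Separated : Prop where
  x_ne : cell φ stepX ≠ 0
  y_ne : cell φ stepY ≠ 0
  xy_ne : cell φ stepX ≠ cell φ stepY

variable {φ}

lemma left_ne_right (hs : Separated φ) (e : Cells φ × Fin 3) : leftFace φ e ≠ rightFace φ e := by
  obtain ⟨a, k⟩ := e
  intro h
  have h' : cell φ (leftOffset k) = cell φ (rightOffset k) := add_left_cancel h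
  fin_cases k
  · exact hs.x_ne (by simpa [leftOffset, rightOffset] using h'.symm)
  · exact hs.y_ne (by simpa [leftOffset, rightOffset] using h'.symm)
  · exact hs.xy_ne h'.symm

variable (φ) in
/-- The chain of the edges at a vertex. -/
def starEdges (v : Cells φ × Bool) (e : Cells φ × Fin 3) : ZMod 2 :=
  ends (srcVertex φ e) (tgtVertex φ e) v

variable (φ) in
/-- The chain of the edges of a hexagon. -/
def faceEdges (f : Cells φ) (e : Cells φ × Fin 3) : ZMod 2 :=
  ends (leftFace φ e) (rightFace φ e) f

lemma starChain_hexModel (v : Cells φ × Bool) : (hexModel φ).starChain v = starEdges φ v :=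
  funext fun e => Tessellation.starChain_eq_ends _ (src_ne_tgt φ) (fun _ _ => Iff.rfl) v e

/-- Separation matters here: an edge with the same hexagon on both sides would have coefficient one
in `faceChain` but zero in `ends`. -/
lemma faceChain_hexModel (hs : Separated φ) (f : Cells φ) :
    (hexModel φ).faceChain f = faceEdges φ f :=
  funext fun e => Tessellation.starChain_eq_ends (hexModel φ).dual (left_ne_right hs)
    (fun _ _ => Iff.rfl) f e

lemma exists_displaces {V E : Type*} [Fintype E] {src tgt : E → V} {hol : E → ℤ × ℤ}
    {v : Cells φ → V} (hφ : Function.Injective φ) {n : ℕ}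
    (hX : Displaces src tgt hol v stepX n) (hY : Displaces src tgt hol v stepY n) (t : ℤ × ℤ) :
    ∃ k, Displaces src tgt hol v t k := by
  have h : t = (t.1 + t.2) • stepX + (-t.2) • stepY := by
    ext <;> simp [stepX, stepY]
  rw [h]
  exact ⟨_, (hX.zsmul hφ _).add hφ (hY.zsmul hφ _)⟩

lemma mod2_surjective : Function.Surjective mod2 := by
  rintro ⟨s, t⟩
  obtain ⟨i, rfl⟩ := ZMod.intCast_surjective s
  obtain ⟨j, rfl⟩ := ZMod.intCast_surjective t
  exact ⟨(i, j), rfl⟩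

/-- A graph in which all displacements can be walked has closed walks of every holonomy. -/
lemma exists_cycle {V E : Type*} [Fintype E] {src tgt : E → V} {hol : E → ℤ × ℤ}
    {v : Cells φ → V} (hφ : Function.Injective φ) {k : ℤ × ℤ} {n : ℕ}
    (h : Displaces src tgt hol v (φ k) n) :
    ∃ c, graphBoundary src tgt c = 0 ∧ weight c ≤ n ∧ holonomy hol c = mod2 k := by
  have h' := h 0
  rwa [cell_period, add_zero, period_apply hφ, Reach, ends_self] at h'

lemma exists_path {V E : Type*} [Fintype E] {src tgt : E → V} {hol : E → ℤ × ℤ}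
    {v : Cells φ → V} (hall : ∀ t, ∃ k, Displaces src tgt hol v t k) (a b : Cells φ) :
    ∃ d, graphBoundary src tgt d = ends (v a) (v b) := by
  obtain ⟨t, ht⟩ := QuotientAddGroup.mk'_surjective φ.range (b - a)
  obtain ⟨k, hk⟩ := hall t
  obtain ⟨d, hd, -⟩ := hk a
  exact ⟨d, by rw [hd, ht, add_sub_cancel]⟩

variable [Fintype (Cells φ)]

instance : Fintype (hexModel φ).V := inferInstanceAs (Fintype (Cells φ × Bool))
instance : Fintype (hexModel φ).E := inferInstanceAs (Fintype (Cells φ × Fin 3))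
instance : Fintype (hexModel φ).F := inferInstanceAs (Fintype (Cells φ))
instance : Fintype (hexModel φ).dual.V := inferInstanceAs (Fintype (Cells φ))

lemma boundary₁_hexModel :
    (hexModel φ).boundary₁ = graphBoundary (srcVertex φ) (tgtVertex φ) :=
  Tessellation.boundary₁_eq_graphBoundary _ (src_ne_tgt φ) fun _ _ => Iff.rfl

lemma dual_boundary₁_hexModel (hs : Separated φ) :
    (hexModel φ).dual.boundary₁ = graphBoundary (leftFace φ) (rightFace φ) :=
  Tessellation.boundary₁_eq_graphBoundary (hexModel φ).dual (left_ne_right hs)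
    fun _ _ => Iff.rfl

section

variable {M : Type*} [AddCommGroup M] [Module (ZMod 2) M]

lemma sum_ite_add_smul {G : Type*} [AddCommGroup G] [Fintype G] (s f : G) (h : G → M) :
    ∑ a, (if f = a + s then (1 : ZMod 2) else 0) • h a = h (f - s) := by
  rw [Finset.sum_eq_single (f - s)]
  · simp
  · intro a _ ha
    rw [if_neg, zero_smul]
    rintro rfl
    simp at ha
  · simp

lemma sum_faceEdges_smul (f : Cells φ) (h : Cells φ × Fin 3 → M) :
    ∑ e, faceEdges φ f e • h e =
      ∑ k, (h (f - cell φ (leftOffset k), k) + h (f - cell φ (rightOffset k), k)) := by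
  rw [Fintype.sum_prod_type_right]
  refine Finset.sum_congr rfl fun k _ => ?_
  simp only [faceEdges, ends, Pi.add_apply, add_smul, Finset.sum_add_distrib, Pi.single_apply]
  rw [← sum_ite_add_smul _ f fun a => h (a, k), ← sum_ite_add_smul _ f fun a => h (a, k)]
  rfl

lemma sum_starEdges_even_smul (b : Cells φ) (h : Cells φ × Fin 3 → M) :
    ∑ e, starEdges φ (b, false) e • h e = ∑ k, h (b, k) := by
  rw [Fintype.sum_prod_type_right]
  refine Finset.sum_congr rfl fun k _ => ?_
  rw [Finset.sum_eq_single b]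
  · simp [starEdges, ends, srcVertex, tgtVertex]
  · intro a _ ha
    simp [starEdges, ends, srcVertex, tgtVertex, ha.symm]
  · simp

lemma sum_starEdges_odd_smul (b : Cells φ) (h : Cells φ × Fin 3 → M) :
    ∑ e, starEdges φ (b, true) e • h e = ∑ k, h (b - cell φ (tgtOffset k), k) := by
  rw [Fintype.sum_prod_type_right]
  refine Finset.sum_congr rfl fun k _ => ?_
  rw [← sum_ite_add_smul _ b fun a => h (a, k)]
  refine Finset.sum_congr rfl fun a _ => ?_
  simp only [starEdges, ends, srcVertex, tgtVertex, Pi.add_apply, Pi.single_apply, Prod.mk.injEq,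
    Bool.true_eq_false, and_false, and_true, if_false, zero_add]
  congr

end

/-- The three hexagons at a vertex are separated pairwise by its three edges. As dual edges these
form a triangle, which has no boundary. -/
lemma starEdges_dotProduct_faceEdges (v : Cells φ × Bool) (f : Cells φ) :
    starEdges φ v ⬝ᵥ faceEdges φ f = 0 := by
  obtain ⟨b, _ | _⟩ := v
  · refine (sum_starEdges_even_smul b (faceEdges φ f)).trans ?_
    have h : ends b (b + cell φ stepX) + ends b (b + cell φ stepY) +
        ends (b + cell φ stepY) (b + cell φ stepX) = 0 := by
      rw [add_assoc, ends_add_ends]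
      exact CharTwo.add_self_eq_zero _
    simpa [faceEdges, leftFace, rightFace, leftOffset, rightOffset, Fin.sum_univ_three] using
      congrFun h f
  · refine (sum_starEdges_odd_smul b (faceEdges φ f)).trans ?_
    have h : ends b (b + cell φ stepX) +
        ends (b - (cell φ stepY - cell φ stepX)) (b + cell φ stepX) +
        ends b (b - (cell φ stepY - cell φ stepX)) = 0 := by
      rw [add_assoc, add_comm (ends (b - _) _), ends_add_ends]
      exact CharTwo.add_self_eq_zero _
    have h1 : b - (cell φ stepY - cell φ stepX) + cell φ stepY = b + cell φ stepX := by abel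
    have h2 : b - cell φ stepY + cell φ stepX = b - (cell φ stepY - cell φ stepX) := by abel
    simp only [faceEdges, leftFace, rightFace, leftOffset, rightOffset, tgtOffset,
      Fin.sum_univ_three, Matrix.cons_val, map_zero, map_sub, sub_zero, add_zero, sub_add_cancel,
      h1, h2]
    exact congrFun h f

/-- The two edges of class `0` have period zero. The other four give the periods of two walks from
`f - stepY`, by `stepY` and `stepY - stepX` in either order, which agree and cancel modulo two. -/
lemma holonomy_faceEdges (hφ : Function.Injective φ) (f : Cells φ) :
    holonomy (edgeHol φ) (faceEdges φ f) = 0 := by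
  rw [holonomy, Fintype.linearCombination_apply, sum_faceEdges_smul]
  have h1 := period_add hφ (f - cell φ stepY) stepY (stepY - stepX)
  have h2 := period_add hφ (f - cell φ stepY) (stepY - stepX) stepY
  rw [add_comm, h1] at h2
  have h4 : f - cell φ stepY + (cell φ stepY - cell φ stepX) = f - cell φ stepX := by abel
  have h3 := congrArg mod2 h2
  simp only [map_add, map_sub, sub_add_cancel, h4] at h3
  simp only [edgeHol, Fin.sum_univ_three, leftOffset, rightOffset, tgtOffset, Matrix.cons_val,
    period_zero hφ, map_zero, sub_zero, zero_add]
  have h5 := add_self_prod (mod2 (period (f - cell φ stepY) stepY) +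
    mod2 (period f (stepY - stepX)))
  nth_rewrite 2 [h3] at h5
  rw [← h5]
  abel

/-- The dual edges around a vertex form a triangle, and the period along one side is the sum of
those along the other two. -/
lemma holonomy_starEdges (hφ : Function.Injective φ) (v : Cells φ × Bool) :
    holonomy (dualHol φ) (starEdges φ v) = 0 := by
  rw [holonomy, Fintype.linearCombination_apply]
  obtain ⟨b, _ | _⟩ := v
  · rw [sum_starEdges_even_smul]
    have h := congrArg mod2 (period_add hφ b stepY (stepX - stepY))
    rw [add_sub_cancel, map_add] at h
    simp only [dualHol, leftFace, Fin.sum_univ_three, leftOffset, rightOffset, Matrix.cons_val,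
      map_zero, sub_zero, add_zero]
    rw [add_assoc, ← h, add_self_prod]
  · rw [sum_starEdges_odd_smul]
    have h := congrArg mod2 (period_add hφ b (stepX - stepY) stepY)
    have h1 : b - (cell φ stepY - cell φ stepX) = b + (cell φ stepX - cell φ stepY) := by abel
    rw [sub_add_cancel, map_add, map_sub] at h
    simp only [dualHol, leftFace, Fin.sum_univ_three, leftOffset, rightOffset, tgtOffset,
      Matrix.cons_val, map_zero, map_sub, sub_zero, add_zero, sub_add_cancel, h1]
    rw [add_assoc, add_comm (mod2 (period (b + _) _)), ← h, add_self_prod]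

/-- The walk goes along the edge `(a, 2)` to an odd vertex, then backwards along `(a + stepX, 1)`,
which ends at the same odd vertex. -/
lemma displaces_even_stepX (hφ : Function.Injective φ) : Displaces (srcVertex φ) (tgtVertex φ)
    (edgeHol φ) (fun a => (a, false)) stepX 2 := by
  intro a
  have h1 := Reach.edge (srcVertex φ) (tgtVertex φ) (edgeHol φ) (a, 2)
  have h2 := Reach.edge (srcVertex φ) (tgtVertex φ) (edgeHol φ) (a + cell φ stepX, 1)
  have h3 := period_add hφ a stepX (stepY - stepX)
  rw [add_sub_cancel] at h3
  have h4 : a + cell φ stepX + (cell φ stepY - cell φ stepX) = a + cell φ stepY := by abel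
  simp only [srcVertex, tgtVertex, edgeHol, tgtOffset, Matrix.cons_val, map_sub, h4] at h1 h2
  have h5 := h1.trans h2.symm
  rwa [h3, map_add, add_assoc, add_self_prod, add_zero] at h5

lemma displaces_even_stepY (hφ : Function.Injective φ) : Displaces (srcVertex φ) (tgtVertex φ)
    (edgeHol φ) (fun a => (a, false)) stepY 2 := by
  intro a
  have h1 := Reach.edge (srcVertex φ) (tgtVertex φ) (edgeHol φ) (a, 2)
  have h2 := Reach.edge (srcVertex φ) (tgtVertex φ) (edgeHol φ) (a + cell φ stepY, 0)
  simp only [srcVertex, tgtVertex, edgeHol, tgtOffset, Matrix.cons_val, map_zero, add_zero,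
    period_zero hφ] at h1 h2
  have h3 := h1.trans h2.symm
  rwa [add_zero] at h3

/-- Crossing an edge of class `k` leads from the hexagon on its left to the one on its right. -/
lemma displaces_face (k : Fin 3) : Displaces (leftFace φ) (rightFace φ) (dualHol φ)
    (fun a => a) (rightOffset k - leftOffset k) 1 := by
  intro a
  have h := Reach.edge (leftFace φ) (rightFace φ) (dualHol φ) (a - cell φ (leftOffset k), k)
  have h1 : a - cell φ (leftOffset k) + cell φ (rightOffset k) =
    a + (cell φ (rightOffset k) - cell φ (leftOffset k)) := by abel
  simpa only [leftFace, rightFace, dualHol, sub_add_cancel, h1, map_sub] using h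

lemma exists_displaces_even (hφ : Function.Injective φ) (t : ℤ × ℤ) :
    ∃ k, Displaces (srcVertex φ) (tgtVertex φ) (edgeHol φ) (fun a => (a, false)) t k :=
  exists_displaces hφ (displaces_even_stepX hφ) (displaces_even_stepY hφ) t

lemma displaces_face_stepX : Displaces (leftFace φ) (rightFace φ) (dualHol φ)
    (fun a => a) stepX 1 := by
  simpa [leftOffset, rightOffset] using displaces_face (φ := φ) 0

lemma displaces_face_stepY : Displaces (leftFace φ) (rightFace φ) (dualHol φ)
    (fun a => a) stepY 1 := by
  simpa [leftOffset, rightOffset] using displaces_face (φ := φ) 1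

lemma displaces_face_sub : Displaces (leftFace φ) (rightFace φ) (dualHol φ)
    (fun a => a) (stepX - stepY) 1 := by
  simpa [leftOffset, rightOffset] using displaces_face (φ := φ) 2

lemma exists_displaces_face (hφ : Function.Injective φ) (t : ℤ × ℤ) :
    ∃ k, Displaces (leftFace φ) (rightFace φ) (dualHol φ) (fun a => a) t k :=
  exists_displaces hφ displaces_face_stepX displaces_face_stepY t

lemma exists_vertex_path (hφ : Function.Injective φ) (v w : Cells φ × Bool) :
    ∃ d, graphBoundary (srcVertex φ) (tgtVertex φ) d = ends v w := by
  have hbase : ∀ v : Cells φ × Bool, ∃ d,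
      graphBoundary (srcVertex φ) (tgtVertex φ) d = ends (v.1, false) v := by
    rintro ⟨b, _ | _⟩
    · exact ⟨0, by rw [map_zero, ends_self]⟩
    · obtain ⟨d, hd, -⟩ := Reach.edge (srcVertex φ) (tgtVertex φ) (edgeHol φ) (b, 0)
      exact ⟨d, by simpa [srcVertex, tgtVertex, tgtOffset] using hd⟩
  obtain ⟨d₁, h₁⟩ := hbase v
  obtain ⟨d₂, h₂⟩ := hbase w
  obtain ⟨d, hd⟩ := exists_path (exists_displaces_even hφ) v.1 w.1
  refine ⟨d₁ + d + d₂, ?_⟩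
  rw [map_add, map_add, h₁, h₂, hd, ends_comm _ v, ends_add_ends, ends_add_ends]

lemma finrank_range_boundary₁_hexModel (hφ : Function.Injective φ) :
    Module.finrank (ZMod 2) (LinearMap.range (hexModel φ).boundary₁) + 1 =
      2 * Fintype.card (Cells φ) := by
  rw [boundary₁_hexModel]
  have : Nonempty (Cells φ × Bool) := ⟨(0, false)⟩
  refine (finrank_range_graphBoundary (exists_vertex_path hφ)).trans ?_
  rw [Fintype.card_prod, Fintype.card_bool, mul_comm]

lemma finrank_range_dual_boundary₁_hexModel (hφ : Function.Injective φ) (hs : Separated φ) :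
    Module.finrank (ZMod 2) (LinearMap.range (hexModel φ).dual.boundary₁) + 1 =
      Fintype.card (Cells φ) := by
  rw [dual_boundary₁_hexModel hs]
  have : Nonempty (hexModel φ).dual.V := ⟨(0 : Cells φ)⟩
  exact finrank_range_graphBoundary (exists_path (exists_displaces_face hφ))

lemma finrank_chains_hexModel : Module.finrank (ZMod 2) ((hexModel φ).E → ZMod 2) =
    3 * Fintype.card (Cells φ) := by
  rw [Module.finrank_fintype_fun_eq_card]
  change Fintype.card (Cells φ × Fin 3) = _
  rw [Fintype.card_prod, Fintype.card_fin, mul_comm]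

lemma range_le_ker_hexModel (hs : Separated φ) :
    LinearMap.range (hexModel φ).boundary₂ ≤ LinearMap.ker (hexModel φ).boundary₁ := by
  rw [Tessellation.range_boundary₂, Submodule.span_le]
  rintro _ ⟨f, rfl⟩
  refine funext fun v => ?_
  exact (congrArg₂ (fun a b : Cells φ × Fin 3 → ZMod 2 => a ⬝ᵥ b) (starChain_hexModel v)
    (faceChain_hexModel hs f)).trans (starEdges_dotProduct_faceEdges v f)

lemma dual_range_le_ker_hexModel (hs : Separated φ) :
    LinearMap.range (hexModel φ).dual.boundary₂ ≤ LinearMap.ker (hexModel φ).dual.boundary₁ := by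
  rw [Tessellation.range_boundary₂, Submodule.span_le]
  rintro _ ⟨v, rfl⟩
  refine funext fun f => ?_
  exact (congrArg₂ (fun a b : Cells φ × Fin 3 → ZMod 2 => b ⬝ᵥ a) (starChain_hexModel v)
    (faceChain_hexModel hs f)).trans
    ((dotProduct_comm _ _).trans (starEdges_dotProduct_faceEdges v f))

/-- The first homology of the torus over `ZMod 2` has dimension two. -/
theorem finrank_ker_hexModel (hφ : Function.Injective φ) (hs : Separated φ) :
    Module.finrank (ZMod 2) (LinearMap.ker (hexModel φ).boundary₁) =
      Module.finrank (ZMod 2) (LinearMap.range (hexModel φ).boundary₂) + 2 := by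
  -- With `N` hexagons, the cycles have dimension `3 * N - (2 * N - 1) = N + 1` and the boundaries
  -- `N - 1`.
  have h1 := finrank_range_boundary₁_hexModel hφ
  have h2 := finrank_range_dual_boundary₁_hexModel hφ hs
  have h3 := (hexModel φ).finrank_range_boundary₂
  have h4 := LinearMap.finrank_range_add_finrank_ker (hexModel φ).boundary₁
  rw [finrank_chains_hexModel] at h4
  omega

theorem finrank_dual_ker_hexModel (hφ : Function.Injective φ) (hs : Separated φ) :
    Module.finrank (ZMod 2) (LinearMap.ker (hexModel φ).dual.boundary₁) =
      Module.finrank (ZMod 2) (LinearMap.range (hexModel φ).dual.boundary₂) + 2 := by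
  have h1 := finrank_range_boundary₁_hexModel hφ
  have h2 := finrank_range_dual_boundary₁_hexModel hφ hs
  have : Fintype (hexModel φ).dual.F := inferInstanceAs (Fintype (hexModel φ).V)
  have h3 : _ = Module.finrank (ZMod 2) (LinearMap.range (hexModel φ).boundary₁) :=
    (hexModel φ).dual.finrank_range_boundary₂
  have h4 := LinearMap.finrank_range_add_finrank_ker (hexModel φ).dual.boundary₁
  have h5 : Module.finrank (ZMod 2) ((hexModel φ).dual.E → ZMod 2) =
    3 * Fintype.card (Cells φ) := finrank_chains_hexModel
  rw [h5] at h4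
  omega

/-- This turns a nontrivial cycle into one with nonzero holonomy, to which the length estimate
applies. -/
lemma mem_range_hexModel_iff (hφ : Function.Injective φ) (hs : Separated φ)
    {c : Cells φ × Fin 3 → ZMod 2} (hc : graphBoundary (srcVertex φ) (tgtVertex φ) c = 0) :
    c ∈ LinearMap.range (hexModel φ).boundary₂ ↔ holonomy (edgeHol φ) c = 0 := by
  refine Tessellation.mem_range_boundary₂_iff (hexModel φ) (H := holonomy (edgeHol φ)) ?_
    (range_le_ker_hexModel hs) (finrank_ker_hexModel hφ hs) ?_ ?_
  · intro f
    exact (congrArg (holonomy (edgeHol φ)) (faceChain_hexModel hs f)).trans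
      (holonomy_faceEdges hφ f)
  · intro τ
    obtain ⟨k, rfl⟩ := mod2_surjective τ
    obtain ⟨n, hn⟩ := exists_displaces_even hφ (φ k)
    obtain ⟨c, h1, -, h2⟩ := exists_cycle hφ hn
    exact ⟨c, by rw [boundary₁_hexModel]; exact h1, h2⟩
  · rw [boundary₁_hexModel]
    exact hc

lemma mem_dual_range_hexModel_iff (hφ : Function.Injective φ) (hs : Separated φ)
    {c : Cells φ × Fin 3 → ZMod 2} (hc : graphBoundary (leftFace φ) (rightFace φ) c = 0) :
    c ∈ LinearMap.range (hexModel φ).dual.boundary₂ ↔ holonomy (dualHol φ) c = 0 := by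
  refine Tessellation.mem_range_boundary₂_iff (hexModel φ).dual (H := holonomy (dualHol φ)) ?_
    (dual_range_le_ker_hexModel hs) (finrank_dual_ker_hexModel hφ hs) ?_ ?_
  · intro v
    exact (congrArg (holonomy (dualHol φ)) (starChain_hexModel v)).trans
      (holonomy_starEdges hφ v)
  · intro τ
    obtain ⟨k, rfl⟩ := mod2_surjective τ
    obtain ⟨n, hn⟩ := exists_displaces_face hφ (φ k)
    obtain ⟨c, h1, -, h2⟩ := exists_cycle hφ hn
    exact ⟨c, by rw [dual_boundary₁_hexModel hs]; exact h1, h2⟩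
  · rw [dual_boundary₁_hexModel hs]
    exact hc

section Lengths

variable {W : Type*} [SeminormedAddCommGroup W] (emb : ℤ × ℤ →+ W) {r ρ : ℝ}

/-- A nontrivial cycle is at least as long as the shortest period. -/
theorem le_length_hexModel (hφ : Function.Injective φ) (hs : Separated φ) (shift : W)
    (hstep : ∀ k, ‖emb (tgtOffset k) + shift‖ ≤ r) (hρ : ∀ t, t ≠ 0 → ρ ≤ ‖emb (φ t)‖) :
    ∀ w ∈ (hexModel φ).nontrivialCycleLengths, ρ ≤ w * r := by
  rintro _ ⟨c, h1, h2, rfl⟩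
  rw [LinearMap.mem_ker, boundary₁_hexModel] at h1
  have h1' : graphBoundary (srcVertex φ) (tgtVertex φ) c = 0 := h1
  -- A vertex is placed at the chosen representative of its hexagon, and `shift` leads from even to
  -- odd vertices. With this choice every edge becomes a vector `emb (tgtOffset k) + shift`.
  refine le_weight_of_holonomy_ne_zero (srcVertex φ) (tgtVertex φ) (edgeHol φ) (emb.comp φ)
    (fun v => emb (Quotient.out v.1) + if v.2 then shift else 0) (src_ne_tgt φ) ?_ hρ h1' ?_
  · rintro ⟨a, k⟩
    convert hstep k using 2
    simp only [srcVertex, tgtVertex, edgeHol, AddMonoidHom.comp_apply, period_spec, map_add,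
      map_sub, if_true, Bool.false_eq_true, if_false]
    abel
  · intro h
    exact h2 ((mem_range_hexModel_iff hφ hs h1').2 h)

/-- A nontrivial cycle of the dual tessellation is at least as long as the shortest period. -/
theorem le_dual_length_hexModel (hφ : Function.Injective φ) (hs : Separated φ)
    (hstep : ∀ k, ‖emb (rightOffset k - leftOffset k)‖ ≤ r)
    (hρ : ∀ t, t ≠ 0 → ρ ≤ ‖emb (φ t)‖) :
    ∀ w ∈ (hexModel φ).dual.nontrivialCycleLengths, ρ ≤ w * r := by
  rintro _ ⟨c, h1, h2, rfl⟩
  rw [LinearMap.mem_ker, dual_boundary₁_hexModel hs] at h1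
  have h1' : graphBoundary (leftFace φ) (rightFace φ) c = 0 := h1
  refine le_weight_of_holonomy_ne_zero (leftFace φ) (rightFace φ) (dualHol φ) (emb.comp φ)
    (fun f => emb (Quotient.out f)) (left_ne_right hs) ?_ hρ h1' ?_
  · rintro ⟨a, k⟩
    convert hstep k using 2
    have h : a + cell φ (leftOffset k) + cell φ (rightOffset k - leftOffset k) =
        a + cell φ (rightOffset k) := by
      rw [map_sub]
      abel
    simp only [leftFace, rightFace, dualHol, AddMonoidHom.comp_apply, period_spec, map_add,
      map_sub]
    rw [map_sub] at h
    rw [h]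
    abel
  · intro h
    exact h2 ((mem_dual_range_hexModel_iff hφ hs h1').2 h)

end Lengths

/-- Needed for the minimum in the `X`-distance to exist. A closed walk by the first period has
nonzero holonomy. -/
lemma exists_length_hexModel (hφ : Function.Injective φ) (hs : Separated φ) :
    (hexModel φ).nontrivialCycleLengths.Nonempty := by
  obtain ⟨n, hn⟩ := exists_displaces_even hφ (φ (1, 0))
  obtain ⟨c, h1, -, h2⟩ := exists_cycle hφ hn
  refine ⟨_, c, ?_, fun h => ?_, rfl⟩
  · rw [boundary₁_hexModel]
    exact h1
  · have h3 := ((mem_range_hexModel_iff hφ hs h1).1 h).symm.trans h2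
    exact absurd (congrArg Prod.fst h3) (by simp [mod2])

/-- A period that can be walked in `n` steps gives a nontrivial dual cycle of that length. -/
lemma exists_dual_length_hexModel (hφ : Function.Injective φ) (hs : Separated φ) {n : ℕ}
    (hn : Displaces (leftFace φ) (rightFace φ) (dualHol φ) (fun a => a) (φ (1, 0)) n) :
    ∃ w ∈ (hexModel φ).dual.nontrivialCycleLengths, w ≤ n := by
  obtain ⟨c, h1, h3, h2⟩ := exists_cycle hφ hn
  refine ⟨_, ⟨c, ?_, fun h => ?_, rfl⟩, h3⟩
  · rw [dual_boundary₁_hexModel hs]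
    exact h1
  · have h3 := ((mem_dual_range_hexModel_iff hφ hs h1).1 h).symm.trans h2
    exact absurd (congrArg Prod.fst h3) (by simp [mod2])

end Model

/-! ### The sixth root of unity and the Eisenstein norm. -/

section Eisenstein

lemma ω_eq : ω = ⟨1 / 2, √3 / 2⟩ := by
  have h : ω = Complex.exp ((Real.pi / 3 : ℝ) * Complex.I) := by
    rw [ω]
    push_cast
    rfl
  rw [h]
  apply Complex.ext
  · rw [Complex.exp_ofReal_mul_I_re, Real.cos_pi_div_three]
  · rw [Complex.exp_ofReal_mul_I_im, Real.sin_pi_div_three]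

lemma ω_sq : ω ^ 2 = ω - 1 := by
  have h : √3 * √3 = 3 := Real.mul_self_sqrt (by norm_num)
  rw [ω_eq, pow_two]
  apply Complex.ext
  · simp only [Complex.mul_re, Complex.sub_re, Complex.one_re]
    linarith
  · simp only [Complex.mul_im, Complex.sub_im, Complex.one_im]
    ring

lemma ω_pow_three : ω ^ 3 = -1 := by
  linear_combination (ω + 1) * ω_sq

lemma ω_pow_six : ω ^ 6 = 1 := by
  linear_combination (ω ^ 3 - 1) * ω_pow_three

lemma normSq_add_mul_ω (a b : ℤ) :
    Complex.normSq (a + b * ω) = ((a ^ 2 + a * b + b ^ 2 : ℤ) : ℝ) := by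
  have h : √3 * √3 = 3 := Real.mul_self_sqrt (by norm_num)
  rw [ω_eq, Complex.normSq_apply]
  simp only [Complex.add_re, Complex.add_im, Complex.intCast_re, Complex.intCast_im,
    Complex.mul_re, Complex.mul_im]
  push_cast
  linear_combination (b : ℝ) ^ 2 / 4 * h

lemma normSq_one_add_ω : Complex.normSq (1 + ω) = 3 := by
  have h := normSq_add_mul_ω 1 1
  norm_num at h
  exact h

lemma one_le_norm_form {a b : ℤ} (h : (a, b) ≠ 0) : 1 ≤ a ^ 2 + a * b + b ^ 2 := by
  by_contra! hlt
  have h1 : a = 0 := by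
    by_contra ha
    have : 0 < a ^ 2 := sq_pos_iff.2 ha
    -- Here `4 * (a ^ 2 + a * b + b ^ 2) = 3 * a ^ 2 + (a + 2 * b) ^ 2`.
    nlinarith [sq_nonneg (a + 2 * b)]
  have h2 : b = 0 := by
    by_contra hb
    have : 0 < b ^ 2 := sq_pos_iff.2 hb
    nlinarith [sq_nonneg (b + 2 * a)]
  exact h (by rw [h1, h2]; rfl)

end Eisenstein

/-! ### The lattice of centres and its sublattices of periods. -/

section Lattice

/-- The lattice vector with given coordinates, from the centre of a hexagon to that of another. -/
def hexVector (l : ℝ) (u : ℂ) : ℤ × ℤ →+ ℂ where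
  toFun t := l * u * (1 + ω) * (t.1 + t.2 * ω)
  map_zero' := by simp
  map_add' s t := by
    push_cast [Prod.fst_add, Prod.snd_add]
    ring

lemma hexVector_apply (l : ℝ) (u : ℂ) (a b : ℤ) :
    hexVector l u (a, b) = l * u * (1 + ω) * (a + b * ω) := rfl

lemma mem_centers_iff {l : ℝ} {u c₀ c : ℂ} :
    c ∈ centers l u c₀ ↔ ∃ t, c = c₀ + hexVector l u t :=
  ⟨fun ⟨a, b, h⟩ => ⟨(a, b), h⟩, fun ⟨t, h⟩ => ⟨t.1, t.2, h⟩⟩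

lemma normSq_hexVector {l : ℝ} {u : ℂ} (hu : ‖u‖ = 1) (a b : ℤ) :
    Complex.normSq (hexVector l u (a, b)) =
      3 * l ^ 2 * ((a ^ 2 + a * b + b ^ 2 : ℤ) : ℝ) := by
  rw [hexVector_apply, map_mul, map_mul, map_mul, normSq_add_mul_ω, normSq_one_add_ω,
    Complex.normSq_ofReal, Complex.normSq_eq_norm_sq u, hu]
  ring

lemma mem_periods_iff {L : ℝ} {t : ℂ} :
    t ∈ periods L ↔ ∃ i j : ℤ, t = L * (i + j * ω) := by
  rw [periods, AddSubgroup.mem_closure_pair]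
  refine exists_congr fun i => exists_congr fun j => ?_
  rw [eq_comm, zsmul_eq_mul, zsmul_eq_mul]
  constructor <;> rintro rfl <;> ring

/-- Multiplication by the Eisenstein integer `p + q ω`, in coordinates. -/
def mulMap (p q : ℤ) : ℤ × ℤ →+ ℤ × ℤ where
  toFun t := (t.1 * p - t.2 * q, t.1 * q + t.2 * (p + q))
  map_zero' := by simp
  map_add' s t := by
    ext <;> simp only [Prod.fst_add, Prod.snd_add] <;> ring

lemma mulMap_apply (p q i j : ℤ) : mulMap p q (i, j) = (i * p - j * q, i * q + j * (p + q)) := rfl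

lemma hexVector_mulMap (l : ℝ) (u : ℂ) (p q i j : ℤ) :
    hexVector l u (mulMap p q (i, j)) = hexVector l u (p, q) * (i + j * ω) := by
  rw [mulMap_apply, hexVector_apply, hexVector_apply]
  push_cast
  linear_combination -(l * u * (1 + ω) * q * j) * ω_sq

/-- The index of the ideal of multiples of `p + q ω` is its norm. -/
lemma card_cells_mulMap {p q : ℤ} (hinj : Function.Injective (mulMap p q)) :
    (Nat.card (Cells (mulMap p q)) : ℤ) = p ^ 2 + p * q + q ^ 2 := by
  -- The index is the determinant of the multiplication, `p * (p + q) + q ^ 2`.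
  have h := AddSubgroup.index_eq_natAbs_det (Module.Basis.finTwoProd ℤ) (mulMap p q).range
    ((Module.Basis.finTwoProd ℤ).map (AddMonoidHom.ofInjective hinj).toIntLinearEquiv)
  have h0 : 0 ≤ p ^ 2 + p * q + q ^ 2 := by nlinarith [sq_nonneg (p + q), sq_nonneg p, sq_nonneg q]
  have h1 : (mulMap p q).range.index = (p ^ 2 + p * q + q ^ 2).natAbs := by
    rw [h]
    congr 1
    rw [Module.Basis.det_apply, Matrix.det_fin_two]
    have hv : ∀ t, (AddMonoidHom.ofInjective hinj t : ℤ × ℤ) = mulMap p q t := fun _ => rfl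
    simp [Module.Basis.toMatrix_apply, hv, mulMap_apply]
    ring
  rw [← AddSubgroup.index_eq_card, h1, Int.natCast_natAbs, abs_of_nonneg h0]

end Lattice

/-! ### Metric consequences of a tiling. -/

/-- The basic assumptions on a tiling of the parallelogram in lattice coordinates: `p + q ω` is the
Eisenstein integer that relates the centres of the hexagons to the periods. -/
structure TilingData (l : ℝ) (u : ℂ) (lam : ℕ) (p q : ℤ) : Prop where
  l_pos : 0 < l
  lam_pos : 0 < lam
  norm_u : ‖u‖ = 1
  side_eq : ((lam * l : ℝ) : ℂ) = hexVector l u (p, q)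

namespace TilingData

variable {l : ℝ} {u : ℂ} {lam : ℕ} {p q : ℤ}

lemma hexVector_period (D : TilingData l u lam p q) (i j : ℤ) :
    hexVector l u (mulMap p q (i, j)) = (lam * l : ℝ) * (i + j * ω) := by
  rw [hexVector_mulMap, D.side_eq]

lemma hexVector_mem_periods_iff (D : TilingData l u lam p q) (t : ℤ × ℤ) :
    hexVector l u t ∈ periods (lam * l) ↔ t ∈ (mulMap p q).range := by
  have hinj : Function.Injective (hexVector l u) := by
    rw [injective_iff_map_eq_zero]
    rintro ⟨a, b⟩ h
    by_contra hne
    have h1 := normSq_hexVector (l := l) D.norm_u a b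
    rw [h, map_zero] at h1
    have h2 : (1 : ℝ) ≤ ((a ^ 2 + a * b + b ^ 2 : ℤ) : ℝ) := by
      exact_mod_cast one_le_norm_form hne
    have h3 : 0 < 3 * l ^ 2 := by
      have := D.l_pos
      positivity
    nlinarith
  rw [mem_periods_iff]
  constructor
  · rintro ⟨i, j, h⟩
    refine ⟨(i, j), hinj ?_⟩
    rw [D.hexVector_period, h]
  · rintro ⟨⟨i, j⟩, rfl⟩
    exact ⟨i, j, D.hexVector_period i j⟩

/-- Both sides are the squared length of the side of the parallelogram divided by `l ^ 2`; the
factor `3` is the norm of `1 + ω`. -/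
lemma lam_sq (D : TilingData l u lam p q) : (lam : ℤ) ^ 2 = 3 * (p ^ 2 + p * q + q ^ 2) := by
  have h := normSq_hexVector (l := l) D.norm_u p q
  rw [← D.side_eq, Complex.normSq_ofReal] at h
  have hl : l ^ 2 ≠ 0 := pow_ne_zero 2 D.l_pos.ne'
  have h1 : (lam : ℝ) ^ 2 = 3 * ((p ^ 2 + p * q + q ^ 2 : ℤ) : ℝ) := by
    apply mul_right_cancel₀ hl
    linarith
  exact_mod_cast h1

lemma three_dvd (D : TilingData l u lam p q) : 3 ∣ lam := by
  have h : (3 : ℤ) ∣ (lam : ℤ) ^ 2 := ⟨_, D.lam_sq⟩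
  exact_mod_cast Int.prime_three.dvd_of_dvd_pow h

/-- Periods are the products of `lam * l` with Eisenstein integers, and nonzero Eisenstein integers
have norm at least one. -/
lemma le_norm_period (D : TilingData l u lam p q) (t : ℤ × ℤ) (ht : t ≠ 0) :
    lam * l ≤ ‖hexVector l u (mulMap p q t)‖ := by
  obtain ⟨i, j⟩ := t
  rw [D.hexVector_period, norm_mul, Complex.norm_real, Real.norm_eq_abs,
    abs_of_nonneg (mul_nonneg (Nat.cast_nonneg _) D.l_pos.le)]
  apply le_mul_of_one_le_right (mul_nonneg (Nat.cast_nonneg _) D.l_pos.le)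
  have h1 : (1 : ℝ) ≤ Complex.normSq (i + j * ω) := by
    rw [normSq_add_mul_ω]
    exact_mod_cast one_le_norm_form ht
  rw [Complex.normSq_eq_norm_sq] at h1
  nlinarith [norm_nonneg ((i : ℂ) + j * ω)]

lemma mulMap_injective (D : TilingData l u lam p q) : Function.Injective (mulMap p q) := by
  rw [injective_iff_map_eq_zero]
  intro t h
  by_contra hne
  have h1 := D.le_norm_period t hne
  rw [h, map_zero, norm_zero] at h1
  exact absurd h1 (not_le.2 (mul_pos (Nat.cast_pos.2 D.lam_pos) D.l_pos))

lemma card_cells (D : TilingData l u lam p q) :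
    3 * Nat.card (Cells (mulMap p q)) = lam ^ 2 := by
  have h := card_cells_mulMap D.mulMap_injective
  have h1 := D.lam_sq
  rw [← h] at h1
  exact_mod_cast h1.symm

lemma finite_cells (D : TilingData l u lam p q) : Finite (Cells (mulMap p q)) := by
  apply Nat.finite_of_card_ne_zero
  intro h
  have h1 := D.card_cells
  rw [h, mul_zero] at h1
  exact absurd h1.symm (pow_ne_zero 2 D.lam_pos.ne')

lemma norm_hexVector_of_form_eq_one (D : TilingData l u lam p q) {a b : ℤ}
    (h : a ^ 2 + a * b + b ^ 2 = 1) : ‖hexVector l u (a, b)‖ = √3 * l := by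
  have h1 := normSq_hexVector (l := l) D.norm_u a b
  rw [h, Complex.normSq_eq_norm_sq] at h1
  have h3 : √3 * √3 = 3 := Real.mul_self_sqrt (by norm_num)
  have h2 : ‖hexVector l u (a, b)‖ ^ 2 = (√3 * l) ^ 2 := by
    rw [h1]
    push_cast
    linear_combination -l ^ 2 * h3
  exact (sq_eq_sq₀ (norm_nonneg _) (mul_nonneg (Real.sqrt_nonneg _) D.l_pos.le)).1 h2

/-- The centres of neighbouring hexagons are `√3 * l` apart. This is less than `3 * l ≤ lam * l`,
the least possible length of a period. -/
lemma cell_ne_zero (D : TilingData l u lam p q) {a b : ℤ} (h : a ^ 2 + a * b + b ^ 2 = 1) :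
    cell (mulMap p q) (a, b) ≠ 0 := by
  intro h0
  obtain ⟨k, hk⟩ := (QuotientAddGroup.eq_zero_iff _).1 h0
  have hn := D.norm_hexVector_of_form_eq_one h
  rw [← hk] at hn
  by_cases hk0 : k = 0
  · rw [hk0, map_zero, map_zero, norm_zero] at hn
    exact absurd hn.symm (mul_pos (by positivity) D.l_pos).ne'
  · have h1 := D.le_norm_period k hk0
    rw [hn] at h1
    have h2 : (3 : ℝ) ≤ lam := by exact_mod_cast Nat.le_of_dvd D.lam_pos D.three_dvd
    have h3 : √3 < 3 := by
      rw [Real.sqrt_lt' (by norm_num)]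
      norm_num
    nlinarith [D.l_pos]

lemma separated (D : TilingData l u lam p q) : Separated (mulMap p q) where
  x_ne := D.cell_ne_zero (by norm_num)
  y_ne := D.cell_ne_zero (by norm_num)
  xy_ne := by
    rw [← sub_ne_zero, ← map_sub]
    exact D.cell_ne_zero (a := 0) (b := 1) (by norm_num)

/-- A period can be walked along the dual tessellation in few steps. -/
lemma exists_short_walk [Fintype (Cells (mulMap p q))] (D : TilingData l u lam p q) :
    ∃ n : ℕ, n < lam ∧
    Displaces (leftFace (mulMap p q)) (rightFace (mulMap p q)) (dualHol (mulMap p q))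
      (fun a => a) (mulMap p q (1, 0)) n := by
  have hφ := D.mulMap_injective
  -- By `lam_sq` the assumption says `9 * n ^ 2 ≤ 4 * lam ^ 2`.
  have hlt : ∀ n : ℕ, 3 * (n : ℤ) ^ 2 ≤ 4 * (p ^ 2 + p * q + q ^ 2) → n < lam := by
    intro n hn
    have h1 := D.lam_sq
    have h2 : (0 : ℤ) < lam := by exact_mod_cast D.lam_pos
    have h3 : (n : ℤ) < lam := by nlinarith
    exact_mod_cast h3
  have hpq : mulMap p q (1, 0) = (p, q) := by simp [mulMap_apply]
  rw [hpq]
  have hX := fun n => (displaces_face_stepX (φ := mulMap p q)).zsmul hφ n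
  have hY := fun n => (displaces_face_stepY (φ := mulMap p q)).zsmul hφ n
  have hZ := fun n => (displaces_face_sub (φ := mulMap p q)).zsmul hφ n
  simp only [mul_one] at hX hY hZ
  -- The vector `(p, q)` lies in one of the sectors between two adjacent directions to neighbours.
  -- There it has coordinates `s`, `t` with `s * t ≥ 0` and norm `s ^ 2 + s * t + t ^ 2`. The walk
  -- has `n = |s| + |t|` steps, and four times the norm exceeds `3 * n ^ 2` by `(s - t) ^ 2`. The
  -- three cases cover opposite pairs of sectors.
  by_cases h : 0 ≤ p * q
  · refine ⟨p.natAbs + q.natAbs, hlt _ ?_, ?_⟩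
    · push_cast
      have h1 : |p| * |q| = p * q := by rw [← abs_mul, abs_of_nonneg h]
      nlinarith [sq_abs p, sq_abs q, sq_nonneg (p - q)]
    · have h1 : (p, q) = p • stepX + q • (stepX - stepY) := by
        ext <;> simp [stepX, stepY]
      rw [h1]
      exact (hX p).add hφ (hZ q)
  · push Not at h
    by_cases h' : 0 ≤ (p + q) * (-q)
    · refine ⟨(p + q).natAbs + (-q).natAbs, hlt _ ?_, ?_⟩
      · push_cast
        have h1 : |p + q| * |-q| = (p + q) * (-q) := by rw [← abs_mul, abs_of_nonneg h']
        nlinarith [sq_abs (p + q), sq_abs (-q), sq_nonneg (p + 2 * q)]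
      · have h1 : (p, q) = (p + q) • stepX + (-q) • stepY := by
          ext <;> simp [stepX, stepY]
        rw [h1]
        exact (hX _).add hφ (hY _)
    · push Not at h'
      have h'' : 0 ≤ (p + q) * (-p) := by
        nlinarith [sq_nonneg (p + q), mul_pos_of_neg_of_neg h h']
      refine ⟨(p + q).natAbs + p.natAbs, hlt _ ?_, ?_⟩
      · push_cast
        have h1 : |p + q| * |p| = (p + q) * (-p) := by
          rw [← abs_neg p, ← abs_mul, abs_of_nonneg h'']
        nlinarith [sq_abs (p + q), sq_abs p, sq_nonneg (q + 2 * p)]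
      · have h1 : (p, q) = (p + q) • (stepX - stepY) + p • stepY := by
          ext <;> simp [stepX, stepY]
        rw [h1]
        exact (hZ _).add hφ (hY _)

/-- The shift `l * u * (ω - 1)` leads from the even to the odd vertex of a hexagon. The edges at an
even vertex are then `l * u` times `ω ^ 2`, `-ω` and `1`. -/
lemma norm_edge (D : TilingData l u lam p q) (k : Fin 3) :
    ‖hexVector l u (tgtOffset k) + l * u * (ω - 1)‖ ≤ l := by
  have hω : ‖ω‖ = 1 := by
    have h := normSq_add_mul_ω 0 1
    rw [Complex.normSq_eq_norm_sq] at h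
    norm_num at h
    rcases h with h | h
    · exact h
    · linarith [norm_nonneg ω]
  have hlu : ‖(l : ℂ) * u‖ = l := by
    rw [norm_mul, D.norm_u, mul_one, Complex.norm_real, Real.norm_eq_abs, abs_of_pos D.l_pos]
  fin_cases k
  · have h : hexVector l u (tgtOffset 0) + l * u * (ω - 1) = l * u * ω ^ 2 := by
      rw [ω_sq]
      simp [tgtOffset]
    exact (by rw [h, norm_mul, norm_pow, hω, hlu, one_pow, mul_one] :
      ‖hexVector l u (tgtOffset 0) + l * u * (ω - 1)‖ = l).le
  · have h : hexVector l u (tgtOffset 1) + l * u * (ω - 1) = -(l * u * ω) := by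
      simp only [tgtOffset, stepX, stepY, Matrix.cons_val, Prod.mk_sub_mk, hexVector_apply]
      push_cast
      linear_combination -(l * u) * ω_sq
    exact (by rw [h, norm_neg, norm_mul, hω, hlu, mul_one] :
      ‖hexVector l u (tgtOffset 1) + l * u * (ω - 1)‖ = l).le
  · have h : hexVector l u (tgtOffset 2) + l * u * (ω - 1) = l * u := by
      simp only [tgtOffset, stepY, Matrix.cons_val, hexVector_apply]
      push_cast
      linear_combination -(l * u) * ω_sq
    exact (by rw [h, hlu] :
      ‖hexVector l u (tgtOffset 2) + l * u * (ω - 1)‖ = l).le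

lemma norm_dual_edge (D : TilingData l u lam p q) (k : Fin 3) :
    ‖hexVector l u (rightOffset k - leftOffset k)‖ ≤ √3 * l := by
  fin_cases k
  · exact (D.norm_hexVector_of_form_eq_one (a := 1 - 0) (b := 0 - 0) (by norm_num)).le
  · exact (D.norm_hexVector_of_form_eq_one (a := 1 - 0) (b := -1 - 0) (by norm_num)).le
  · exact (D.norm_hexVector_of_form_eq_one (a := 1 - 1) (b := 0 - -1) (by norm_num)).le

end TilingData

/-! ### Identification of the lattice model with the flat torus. -/

namespace TilingData

variable {l : ℝ} {u : ℂ} {lam : ℕ} {p q : ℤ}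

/-- The embedding of the coordinate torus into the flat torus. -/
def toTorus (D : TilingData l u lam p q) : Cells (mulMap p q) →+ FlatTorus (lam * l) :=
  QuotientAddGroup.map _ _ (hexVector l u) fun t ht => (D.hexVector_mem_periods_iff t).2 ht

lemma toTorus_cell (D : TilingData l u lam p q) (t : ℤ × ℤ) :
    D.toTorus (cell _ t) = (hexVector l u t : FlatTorus (lam * l)) := rfl

lemma toTorus_injective (D : TilingData l u lam p q) : Function.Injective D.toTorus := by
  rw [injective_iff_map_eq_zero]
  intro a ha
  obtain ⟨t, rfl⟩ := QuotientAddGroup.mk'_surjective _ a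
  rw [D.toTorus_cell, QuotientAddGroup.eq_zero_iff, D.hexVector_mem_periods_iff] at ha
  exact (QuotientAddGroup.eq_zero_iff _).2 ha

/-- The even and the odd vertex that belong to the hexagon with centre `c`. -/
def baseVertex (l : ℝ) (u c : ℂ) (b : Bool) : ℂ := corner l u c b.toNat

/-- The centre of a hexagon in the flat torus. -/
def face (D : TilingData l u lam p q) (c₀ : ℂ) (a : Cells (mulMap p q)) : FlatTorus (lam * l) :=
  (c₀ : FlatTorus (lam * l)) + D.toTorus a

/-- A vertex in the flat torus. -/
def vertex (D : TilingData l u lam p q) (c₀ : ℂ) (v : Cells (mulMap p q) × Bool) :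
    FlatTorus (lam * l) :=
  (baseVertex l u c₀ v.2 : FlatTorus (lam * l)) + D.toTorus v.1

/-- An edge in the flat torus. -/
def edge (D : TilingData l u lam p q) (c₀ : ℂ) (e : Cells (mulMap p q) × Fin 3) :
    Sym2 (FlatTorus (lam * l)) :=
  s(D.vertex c₀ (srcVertex _ e), D.vertex c₀ (tgtVertex _ e))

lemma face_injective (D : TilingData l u lam p q) (c₀ : ℂ) : Function.Injective (D.face c₀) :=
  fun _ _ h => D.toTorus_injective (add_left_cancel h)

/-- Otherwise `l * u * (ω - 1)` would be a lattice vector. Its squared length is `l ^ 2`, while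
those of lattice vectors are multiples of `3 * l ^ 2`. -/
lemma vertex_even_ne_odd (D : TilingData l u lam p q) (c₀ : ℂ) (a b : Cells (mulMap p q)) :
    D.vertex c₀ (a, false) ≠ D.vertex c₀ (b, true) := by
  intro h
  obtain ⟨s, rfl⟩ := QuotientAddGroup.mk'_surjective _ a
  obtain ⟨t, rfl⟩ := QuotientAddGroup.mk'_surjective _ b
  simp only [vertex, D.toTorus_cell, ← QuotientAddGroup.mk_add] at h
  rw [QuotientAddGroup.eq, mem_periods_iff] at h
  obtain ⟨i, j, h⟩ := h
  rw [← D.hexVector_period] at h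
  obtain ⟨m, n, hmn⟩ : ∃ m n, mulMap p q (i, j) + s - t = (m, n) := ⟨_, _, rfl⟩
  have h1 : (l : ℂ) * u * (ω - 1) = hexVector l u (m, n) := by
    rw [← hmn, map_sub, map_add, ← h]
    simp only [baseVertex, corner, Bool.toNat_true, Bool.toNat_false]
    ring
  have h2 := normSq_hexVector (l := l) D.norm_u m n
  have h3 : Complex.normSq (ω - 1) = 1 := by
    have := normSq_add_mul_ω (-1) 1
    norm_num at this
    rw [← this]
    congr 1
    ring
  rw [← h1, map_mul, map_mul, Complex.normSq_ofReal, Complex.normSq_eq_norm_sq u, D.norm_u, h3]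
    at h2
  have h4 : (1 : ℝ) = 3 * ((m ^ 2 + m * n + n ^ 2 : ℤ) : ℝ) := by
    apply mul_right_cancel₀ (pow_ne_zero 2 D.l_pos.ne')
    linarith
  have h5 : (1 : ℤ) = 3 * (m ^ 2 + m * n + n ^ 2) := by exact_mod_cast h4
  omega

lemma vertex_injective (D : TilingData l u lam p q) (c₀ : ℂ) :
    Function.Injective (D.vertex c₀) := by
  rintro ⟨a, b⟩ ⟨a', b'⟩ h
  obtain rfl : b = b' := by
    cases b <;> cases b'
    · rfl
    · exact absurd h (D.vertex_even_ne_odd c₀ a a')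
    · exact absurd h.symm (D.vertex_even_ne_odd c₀ a' a)
    · rfl
  exact Prod.ext (D.toTorus_injective (add_left_cancel h)) rfl

/-- The edges at an even vertex lead to three different odd vertices, so an edge of the torus is
determined by its pair of ends. -/
lemma tgtOffset_injective {φ : ℤ × ℤ →+ ℤ × ℤ} (hs : Separated φ) :
    Function.Injective fun k => cell φ (tgtOffset k) := by
  have h1 : cell φ (tgtOffset 0) ≠ cell φ (tgtOffset 1) := by
    simp only [tgtOffset, Matrix.cons_val, map_sub, map_zero]
    exact fun h => hs.xy_ne (sub_eq_zero.1 h.symm).symm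
  have h2 : cell φ (tgtOffset 0) ≠ cell φ (tgtOffset 2) := by
    simp only [tgtOffset, Matrix.cons_val, map_zero]
    exact hs.y_ne.symm
  have h3 : cell φ (tgtOffset 1) ≠ cell φ (tgtOffset 2) := by
    simp only [tgtOffset, Matrix.cons_val, map_sub]
    exact fun h => hs.x_ne (sub_eq_self.1 h)
  intro i j h
  fin_cases i <;> fin_cases j
  · rfl
  · exact absurd h h1
  · exact absurd h h2
  · exact absurd h h1.symm
  · rfl
  · exact absurd h h3
  · exact absurd h h2.symm
  · exact absurd h h3.symm
  · rfl

lemma edge_injective (D : TilingData l u lam p q) (c₀ : ℂ) : Function.Injective (D.edge c₀) := by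
  rintro ⟨a, k⟩ ⟨a', k'⟩ h
  rcases Sym2.eq_iff.1 h with ⟨h1, h2⟩ | ⟨h1, -⟩
  · obtain rfl : a = a' := congrArg Prod.fst (D.vertex_injective c₀ h1)
    have h3 := congrArg Prod.fst (D.vertex_injective c₀ h2)
    exact Prod.ext rfl (tgtOffset_injective D.separated (add_left_cancel h3))
  · exact absurd h1 (D.vertex_even_ne_odd c₀ _ _)

lemma corner_mod_six (l : ℝ) (u c : ℂ) (k : ℕ) : corner l u c (k % 6) = corner l u c k := by
  conv_rhs => rw [corner, ← Nat.div_add_mod k 6, pow_add, pow_mul, ω_pow_six, one_pow, one_mul]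
  rfl

lemma torusEdge_mod_six (l : ℝ) (u : ℂ) (L : ℝ) (c : ℂ) (k : ℕ) :
    torusEdge l u L c (k % 6) = torusEdge l u L c k := by
  rw [torusEdge, torusEdge, corner_mod_six, ← corner_mod_six l u c (k % 6 + 1),
    ← corner_mod_six l u c (k + 1), Nat.mod_add_mod]

/-- The vertices of the hexagon `a` in their order. -/
def cornerVertex (φ : ℤ × ℤ →+ ℤ × ℤ) (a : Cells φ) : Fin 6 → Cells φ × Bool :=
  ![(a, false), (a, true), (a - cell φ stepY, false), (a - cell φ stepX, true),
    (a - cell φ stepX, false), (a + (cell φ stepY - cell φ stepX), true)]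

/-- The edges of the hexagon `a` in their order. -/
def borderEdge (φ : ℤ × ℤ →+ ℤ × ℤ) (a : Cells φ) : Fin 6 → Cells φ × Fin 3 :=
  ![(a, 0), (a - cell φ stepY, 2), (a - cell φ stepY, 1), (a - cell φ stepX, 0),
    (a - cell φ stepX, 2), (a, 1)]

lemma exists_borderEdge_iff {φ : ℤ × ℤ →+ ℤ × ℤ} (a : Cells φ) (e : Cells φ × Fin 3) :
    (∃ k, e = borderEdge φ a k) ↔ a = leftFace φ e ∨ a = rightFace φ e := by
  constructor
  · rintro ⟨k, rfl⟩
    fin_cases k <;> simp [borderEdge, leftFace, rightFace, leftOffset, rightOffset]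
  · obtain ⟨b, m⟩ := e
    rintro (rfl | rfl) <;> fin_cases m
    · exact ⟨0, by simp [borderEdge, leftFace, leftOffset]⟩
    · exact ⟨5, by simp [borderEdge, leftFace, leftOffset]⟩
    · exact ⟨1, by simp [borderEdge, leftFace, leftOffset]⟩
    · exact ⟨3, by simp [borderEdge, rightFace, rightOffset]⟩
    · exact ⟨2, by simp [borderEdge, rightFace, rightOffset]⟩
    · exact ⟨4, by simp [borderEdge, rightFace, rightOffset]⟩

/-- A hexagon owns its corners `0` and `1`. The other four are such corners of neighbours, by `ω ^ 3
= -1`; corner `2` needs only the factorization of `ω ^ 2 - 1`. -/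
lemma corner_eq_vertex (D : TilingData l u lam p q) (c₀ : ℂ) (t : ℤ × ℤ) (k : Fin 6) :
    (corner l u (c₀ + hexVector l u t) k : FlatTorus (lam * l)) =
      D.vertex c₀ (cornerVertex _ (cell _ t) k) := by
  have key : ∀ (s : ℤ × ℤ) (b : Bool), corner l u c₀ k = baseVertex l u c₀ b + hexVector l u s →
      (corner l u (c₀ + hexVector l u t) k : FlatTorus (lam * l)) =
        D.vertex c₀ (cell _ t + cell _ s, b) := by
    intro s b h
    rw [vertex, ← map_add, D.toTorus_cell, ← QuotientAddGroup.mk_add]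
    congr 1
    have h' := map_add (hexVector l u) t s
    simp only [corner] at h ⊢
    linear_combination h - h'
  fin_cases k
  · refine (key 0 false ?_).trans ?_
    · simp [baseVertex]
    · simp [cornerVertex]
  · refine (key 0 true ?_).trans ?_
    · simp [baseVertex]
    · simp [cornerVertex]
  · refine (key (-stepY) false ?_).trans ?_
    · simp only [baseVertex, corner, stepY, Prod.neg_mk, hexVector_apply, Bool.toNat_false]
      push_cast
      linear_combination 0 * ω_sq
    · simp [cornerVertex, sub_eq_add_neg]
  · refine (key (-stepX) true ?_).trans ?_
    · simp only [baseVertex, corner, stepX, Prod.neg_mk, hexVector_apply, Bool.toNat_true]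
      push_cast
      linear_combination l * u * ω_pow_three
    · simp [cornerVertex, sub_eq_add_neg]
  · refine (key (-stepX) false ?_).trans ?_
    · simp only [baseVertex, corner, stepX, Prod.neg_mk, hexVector_apply, Bool.toNat_false]
      push_cast
      linear_combination l * u * ω * ω_pow_three
    · simp [cornerVertex, sub_eq_add_neg]
  · refine (key (stepY - stepX) true ?_).trans ?_
    · simp only [baseVertex, corner, stepX, stepY, Prod.mk_sub_mk, hexVector_apply,
        Bool.toNat_true]
      push_cast
      linear_combination l * u * ω ^ 2 * ω_pow_three
    · simp [cornerVertex]

lemma torusEdge_eq_edge (D : TilingData l u lam p q) (c₀ : ℂ) (t : ℤ × ℤ) (k : Fin 6) :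
    torusEdge l u (lam * l) (c₀ + hexVector l u t) k =
      D.edge c₀ (borderEdge _ (cell _ t) k) := by
  have h1 : torusEdge l u (lam * l) (c₀ + hexVector l u t) k =
      s(D.vertex c₀ (cornerVertex _ (cell _ t) k),
        D.vertex c₀ (cornerVertex _ (cell _ t) (k + 1))) := by
    rw [torusEdge, ← D.corner_eq_vertex, ← D.corner_eq_vertex,
      ← corner_mod_six _ _ _ ((k : ℕ) + 1), Fin.val_add]
    rfl
  have h2 : ∀ a : Cells (mulMap p q), a + (cell _ stepY - cell _ stepX) =
      a - cell _ stepX + cell _ stepY := fun a => by abel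
  have h3 : ∀ a : Cells (mulMap p q), a - cell _ stepY - cell _ stepX + cell _ stepY =
      a - cell _ stepX := fun a => by abel
  rw [h1, edge]
  generalize cell _ t = a
  fin_cases k <;>
    simp only [cornerVertex, borderEdge, srcVertex, tgtVertex, tgtOffset, Fin.reduceFinMk,
      Fin.reduceAdd, Fin.zero_eta, Fin.mk_one, zero_add, Matrix.cons_val, map_zero, map_sub,
      add_zero, sub_add_cancel, h2, h3]
  -- On the sides with odd `k` the border runs from an odd to an even vertex, against the
  -- orientation of the edge.
  · exact Sym2.eq_swap
  · exact Sym2.eq_swap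
  · exact Sym2.eq_swap

end TilingData

namespace TilingData

variable {l : ℝ} {u : ℂ} {lam : ℕ} {p q : ℤ}

lemma range_face (D : TilingData l u lam p q) (c₀ : ℂ) :
    Set.range (D.face c₀) = {x | ∃ c ∈ centers l u c₀, x = (c : FlatTorus (lam * l))} := by
  ext x
  constructor
  · rintro ⟨a, rfl⟩
    obtain ⟨t, rfl⟩ := QuotientAddGroup.mk'_surjective _ a
    exact ⟨_, mem_centers_iff.2 ⟨t, rfl⟩, rfl⟩
  · rintro ⟨c, hc, rfl⟩
    obtain ⟨t, rfl⟩ := mem_centers_iff.1 hc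
    exact ⟨cell _ t, rfl⟩

lemma range_vertex (D : TilingData l u lam p q) (c₀ : ℂ) :
    Set.range (D.vertex c₀) = {x | ∃ c ∈ centers l u c₀, ∃ k : ℕ,
      x = (corner l u c k : FlatTorus (lam * l))} := by
  ext x
  constructor
  · rintro ⟨⟨a, b⟩, rfl⟩
    obtain ⟨t, rfl⟩ := QuotientAddGroup.mk'_surjective _ a
    refine ⟨_, mem_centers_iff.2 ⟨t, rfl⟩, b.toNat, ?_⟩
    rw [vertex, D.toTorus_cell, ← QuotientAddGroup.mk_add]
    congr 1
    simp only [baseVertex, corner]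
    ring
  · rintro ⟨c, hc, k, rfl⟩
    obtain ⟨t, rfl⟩ := mem_centers_iff.1 hc
    rw [← corner_mod_six]
    exact ⟨_, (D.corner_eq_vertex c₀ t ⟨k % 6, Nat.mod_lt _ (by norm_num)⟩).symm⟩

lemma exists_torusEdge_iff (D : TilingData l u lam p q) (c₀ : ℂ) (t : ℤ × ℤ)
    (x : Sym2 (FlatTorus (lam * l))) :
    (∃ k : ℕ, x = torusEdge l u (lam * l) (c₀ + hexVector l u t) k) ↔
      ∃ k : Fin 6, x = D.edge c₀ (borderEdge _ (cell _ t) k) := by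
  constructor
  · rintro ⟨k, rfl⟩
    rw [← torusEdge_mod_six]
    exact ⟨_, D.torusEdge_eq_edge c₀ t ⟨k % 6, Nat.mod_lt _ (by norm_num)⟩⟩
  · rintro ⟨k, rfl⟩
    exact ⟨k, (D.torusEdge_eq_edge c₀ t k).symm⟩

lemma range_edge (D : TilingData l u lam p q) (c₀ : ℂ) :
    Set.range (D.edge c₀) = {x | ∃ c ∈ centers l u c₀, ∃ k : ℕ,
      x = torusEdge l u (lam * l) c k} := by
  ext x
  constructor
  · rintro ⟨e, rfl⟩
    obtain ⟨t, ht⟩ := QuotientAddGroup.mk'_surjective _ (leftFace _ e)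
    obtain ⟨k, hk⟩ := (exists_borderEdge_iff _ e).2 (Or.inl rfl)
    refine ⟨_, mem_centers_iff.2 ⟨t, rfl⟩, (D.exists_torusEdge_iff c₀ t _).2 ⟨k, ?_⟩⟩
    rw [ht, ← hk]
  · rintro ⟨c, hc, hk⟩
    obtain ⟨t, rfl⟩ := mem_centers_iff.1 hc
    obtain ⟨k, rfl⟩ := (D.exists_torusEdge_iff c₀ t x).1 hk
    exact ⟨_, rfl⟩

lemma border_edge_iff (D : TilingData l u lam p q) (c₀ : ℂ) (e : Cells (mulMap p q) × Fin 3)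
    (f : Cells (mulMap p q)) :
    (∃ c ∈ centers l u c₀, D.face c₀ f = (c : FlatTorus (lam * l)) ∧
      ∃ k : ℕ, D.edge c₀ e = torusEdge l u (lam * l) c k) ↔
      f = leftFace _ e ∨ f = rightFace _ e := by
  rw [← exists_borderEdge_iff]
  constructor
  · rintro ⟨c, hc, hf, hk⟩
    obtain ⟨t, rfl⟩ := mem_centers_iff.1 hc
    obtain ⟨k, hk⟩ := (D.exists_torusEdge_iff c₀ t _).1 hk
    obtain rfl : f = cell _ t := D.face_injective c₀ hf
    exact ⟨k, D.edge_injective c₀ hk⟩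
  · rintro ⟨k, hk⟩
    obtain ⟨t, rfl⟩ := QuotientAddGroup.mk'_surjective _ f
    exact ⟨_, mem_centers_iff.2 ⟨t, rfl⟩, rfl,
      (D.exists_torusEdge_iff c₀ t _).2 ⟨k, congrArg _ hk⟩⟩

/-- The hexagonal tessellation of the flat torus in lattice coordinates. -/
def iso (D : TilingData l u lam p q) (c₀ : ℂ) :
    Tessellation.Iso (hexModel (mulMap p q)) (hexTorus l u c₀ (lam * l)) where
  onV := (Equiv.ofInjective _ (D.vertex_injective c₀)).trans (Equiv.setCongr (D.range_vertex c₀))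
  onE := (Equiv.ofInjective _ (D.edge_injective c₀)).trans (Equiv.setCongr (D.range_edge c₀))
  onF := (Equiv.ofInjective _ (D.face_injective c₀)).trans (Equiv.setCongr (D.range_face c₀))
  endpoint_iff v e := by
    change D.vertex c₀ v ∈ D.edge c₀ e ↔ v = srcVertex _ e ∨ v = tgtVertex _ e
    exact Sym2.mem_iff.trans (or_congr (D.vertex_injective c₀).eq_iff
      (D.vertex_injective c₀).eq_iff)
  border_iff e f := D.border_edge_iff c₀ e f

end TilingData

/-! ### Existence of tilings and the final assembly. -/

/-- A tiling of the parallelogram is given by an Eisenstein integer. -/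
lemma exists_tilingData {l : ℝ} (hl : 0 < l) {lam : ℕ} (hlam : 0 < lam) {u c₀ : ℂ}
    (hu : ‖u‖ = 1) (h : TilesParallelogram l u c₀ (lam * l)) :
    ∃ p q, TilingData l u lam p q := by
  have h0 : c₀ ∈ centers l u c₀ := mem_centers_iff.2 ⟨0, by simp⟩
  have h1 : ((lam * l : ℝ) : ℂ) ∈ periods (lam * l) := AddSubgroup.subset_closure (Or.inl rfl)
  obtain ⟨t, ht⟩ := mem_centers_iff.1 (h _ h1 c₀ h0)
  refine ⟨t.1, t.2, hl, hlam, hu, ?_⟩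
  rw [add_comm] at ht
  exact add_left_cancel ht

lemma tilesParallelogram_of_three_dvd (l : ℝ) {lam : ℕ} (h : 3 ∣ lam) :
    TilesParallelogram l 1 0 (lam * l) := by
  obtain ⟨m, rfl⟩ := h
  intro t ht c hc
  obtain ⟨i, j, rfl⟩ := mem_periods_iff.1 ht
  obtain ⟨s, rfl⟩ := mem_centers_iff.1 hc
  -- Since `(1 + ω) * (2 - ω) = 3`, the side `3 * m * l` is the lattice vector with coordinates `(2
  -- * m, -m)`.
  refine mem_centers_iff.2 ⟨mulMap (2 * m) (-m) (i, j) + s, ?_⟩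
  rw [map_add, hexVector_mulMap, hexVector_apply l 1 (2 * m)]
  push_cast
  linear_combination (l * m * (i + j * ω)) * ω_sq

end HexToric

end

theorem corollary2 (l : ℝ) (hl : 0 < l) (lam : ℕ) (hlam : 0 < lam) :
    (3 ∣ lam → HexToric.TilesParallelogram l 1 0 (lam * l)) ∧
    ∀ u c₀ : ℂ, ‖u‖ = 1 → HexToric.TilesParallelogram l u c₀ (lam * l) →
      3 ∣ lam ∧
      ∃ _ : Fintype (HexToric.hexTorus l u c₀ (lam * l)).E,
        HexToric.IsAsymmetricCode (HexToric.hexTorus l u c₀ (lam * l)).code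
          (lam ^ 2) 2 ⌈(lam : ℝ) / √3⌉₊ lam ∧
        ∃ dz dx : ℕ,
          (HexToric.hexTorus l u c₀ (lam * l)).IsZDistance dz ∧
          (HexToric.hexTorus l u c₀ (lam * l)).IsXDistance dx ∧
          ⌈(lam : ℝ) / √3⌉₊ ≤ dz ∧ lam ≤ dx ∧ dz ≠ dx := by
  open HexToric in
  refine ⟨tilesParallelogram_of_three_dvd l, fun u c₀ hu htiles => ?_⟩
  obtain ⟨p, q, D⟩ := exists_tilingData hl hlam hu htiles
  have hφ := D.mulMap_injective
  have hs := D.separated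
  have := D.finite_cells
  let inst : Fintype (Cells (mulMap p q)) := Fintype.ofFinite _
  let i := D.iso c₀
  let instE : Fintype (hexTorus l u c₀ (lam * l)).E := Fintype.ofEquiv _ i.onE
  have hx : ∀ w ∈ (hexTorus l u c₀ (lam * l)).nontrivialCycleLengths, lam ≤ w := by
    intro w hw
    rw [← i.nontrivialCycleLengths_eq] at hw
    -- Edges have length `l` and nonzero periods length at least `lam * l`.
    have h := le_length_hexModel (hexVector l u) hφ hs _ D.norm_edge D.le_norm_period w hw
    exact_mod_cast le_of_mul_le_mul_right h hl
  have hz : ∀ w ∈ (hexTorus l u c₀ (lam * l)).dual.nontrivialCycleLengths,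
      ⌈(lam : ℝ) / √3⌉₊ ≤ w := by
    intro w hw
    rw [← i.dual.nontrivialCycleLengths_eq] at hw
    -- Dual edges have length `√3 * l`, which yields the bound `lam / √3`.
    have h := le_dual_length_hexModel (hexVector l u) hφ hs D.norm_dual_edge D.le_norm_period w hw
    rw [← mul_assoc] at h
    rw [Nat.ceil_le, div_le_iff₀ (by positivity)]
    exact le_of_mul_le_mul_right h hl
  refine ⟨D.three_dvd, instE, ⟨?_, ?_, ?_⟩, ?_⟩
  · rw [← D.card_cells, Nat.card_eq_fintype_card, ← Fintype.card_congr i.onE]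
    change Fintype.card (Cells (mulMap p q) × Fin 3) = _
    rw [Fintype.card_prod, Fintype.card_fin, mul_comm]
  · apply Tessellation.finrank_code
    · exact i.range_le_ker_iff.1 (range_le_ker_hexModel hs)
    · rw [← i.finrank_ker_boundary₁_eq, ← i.finrank_range_boundary₂_eq]
      exact finrank_ker_hexModel hφ hs
  · exact Tessellation.corrects_code _ hlam (Nat.ceil_pos.2 (by positivity)) hx hz
  · obtain ⟨n, hn, hwalk⟩ := D.exists_short_walk
    obtain ⟨w, hw, hwn⟩ := exists_dual_length_hexModel hφ hs hwalk
    have hne := exists_length_hexModel hφ hs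
    rw [i.dual.nontrivialCycleLengths_eq] at hw
    rw [i.nontrivialCycleLengths_eq] at hne
    have hdz := isLeast_csInf (⟨w, hw⟩ : Set.Nonempty _)
    have hdx := isLeast_csInf hne
    refine ⟨_, _, hdz, hdx, hz _ hdz.1, hx _ hdx.1, ?_⟩
    -- The distances are separated by `lam`: `dz ≤ w ≤ n < lam ≤ dx`.
    have h1 := hdz.2 hw
    have h2 := hx _ hdx.1
    omega
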